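/- Let $d\ge 2$, let $\Omega\subset\mathbb R^d$ be a bounded open set with Lipschitz boundary, $\mathbf n$ its outer unit normal (defined at almost every point of $\partial\Omega$, and everywhere if $\partial\Omega$ is $C^1$), $dS$ the surface measure, and suppose that the whole boundary is a fixed solid wall, $\partial\Omega_w=\partial\Omega$. Let $\rho_i,\eta_i,\beta_{\Gamma,i}>0$ ($i=1,2$), $\lambda_c,\gamma,\sigma,\theta_s\in\mathbb R$, and put $$\frac1{\rho(c)}=\frac c{\rho_1}+\frac{1-c}{\rho_2},\quad \frac1{\eta(c)}=\frac c{\eta_1}+\frac{1-c}{\eta_2},\quad \frac1{\beta_\Gamma(c)}=\frac c{\beta_{\Gamma,1}}+\frac{1-c}{\beta_{\Gamma,2}},\quad \alpha=\frac{\rho_2-\rho_1}{\rho_1\rho_2},$$ $$G(c)=\tfrac14c^2(1-c)^2,\qquad f_w(c)=-\tfrac\sigma2\cos(\theta_s)\sin\Big(\frac{(2c-1)\pi}2\Big).$$ Let the second Lamé coefficient $\lambda=\lambda(c)$ and the bulk and wall mobilities $\mathcal M=\mathcal M(c)$, $\mathcal M_\Gamma=\mathcal M_\Gamma(c)$ be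 smooth functions of $c$ (for example constants). Write $\frac{D}{Dt}=\partial_t+\mathbf u\cdot\nabla$, $\mathbf D_\eta=\frac12(\nabla\mathbf u+(\nabla\mathbf u)^T)$, $\boldsymbol\sigma_\eta=2\eta\mathbf D_\eta+\lambda(\nabla\cdot\mathbf u)I-pI$, $\nabla_\Gamma=\nabla-\mathbf n(\mathbf n\cdot\nabla)$, $\frac{D_\Gamma c}{Dt}=\partial_tc+\mathbf u\cdot\nabla_\Gamma c$, $\mathbf u^s=\mathbf u-(\mathbf u\cdot\mathbf n)\mathbf n$, and $L(c)=\rho\lambda_c\gamma^2\partial_nc+f_w'(c)$. Let $J\subset\mathbb R$ be open (for example an open time interval), and let $c,p$ (scalar) and $\mathbf u$ ($\mathbb R^d$-valued) be smooth on $J\times\overline\Omega$, up to the boundary (that is, restrictions of functions that are smooth around each point of this set), such that $\rho(c),\eta(c)$ are well defined and positive on $J\times\overline\Omega$ and $\beta_\Gamma(c)$ is so on $J\times\partial\Omega$. Suppose that in $J\times\Omega$ $$\rho\frac{Dc}{Dt}=\nabla\cdot(\mathcal M\nabla\tilde\mu),\qquad \tilde\mu=\lambda_cG'(c)-\frac{\lambda_c\gamma^2}{\rho}\nabla\cdot(\rho\nabla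 c)+\alpha p,\qquad \frac{D\rho}{Dt}+\rho\nabla\cdot\mathbf u=0,$$ $$\rho\frac{D\mathbf u}{Dt}=\nabla\cdot(2\eta\mathbf D_\eta)+\nabla(\lambda\nabla\cdot\mathbf u)-\nabla p-\nabla\cdot(\lambda_c\gamma^2\rho\,\nabla c\otimes\nabla c),$$ and that for all $t\in J$, at all points of $\partial\Omega$ where the normal exists, $$\frac{D_\Gamma c}{Dt}=-\mathcal M_\Gamma L(c),\qquad \nabla\tilde\mu\cdot\mathbf n=0,\qquad \mathbf u\cdot\mathbf n=0,\qquad \mathbf u^s\cdot\boldsymbol\tau=\beta_\Gamma^{-1}\big(-\mathbf n\cdot\boldsymbol\sigma_\eta\cdot\boldsymbol\tau+L(c)\,\partial_{\boldsymbol\tau}c\big)\ \text{ for every tangent vector }\boldsymbol\tau\perp\mathbf n .$$ Then, for every $t\in J$, all the integrals below are finite, the total energy $$E^{tot}(t)=\int_\Omega\frac{\rho|\mathbf u|^2}2\,dx+\int_\Omega\lambda_c\rho\Big(G(c)+\frac{\gamma^2}2|\nabla c|^2\Big)dx+\int_{\partial\Omega}f_w(c)\,dS$$ is differentiable at $t$,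 and $$\frac{dE^{tot}}{dt}=-\int_\Omega2\eta|\mathbf D_\eta|^2dx-\int_\Omega\lambda|\nabla\cdot\mathbf u|^2dx-\int_\Omega\mathcal M|\nabla\tilde\mu|^2dx-\int_{\partial\Omega}\big(\mathcal M_\Gamma|L(c)|^2+\beta_\Gamma|\mathbf u^s|^2\big)dS ,$$ where $|\mathbf D_\eta|$ is the Frobenius norm. -/

import Mathlib

open MeasureTheory Set Filter Topology
open scoped ContDiff Matrix

noncomputable section

namespace QNSCH

/-- The Euclidean space `ℝ^d`. -/
abbrev Vec (d : ℕ) : Type := EuclideanSpace ℝ (Fin d)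

/-! ### Domains with Lipschitz boundary, outer normal, surface measure -/

/-- `Ω` is a bounded open set with Lipschitz boundary: near each boundary point, and after the
choice of a unit vector `e` as vertical direction, `Ω` is the set of the points that lie strictly
below the graph of a Lipschitz function `φ` of the horizontal component `y - ⟪e, y⟫ e`. -/
structure IsLipschitzDomain {d : ℕ} (Ω : Set (Vec d)) : Prop where
  isOpen : IsOpen Ω
  isBounded : Bornology.IsBounded Ω
  locally_graph : ∀ x ∈ frontier Ω, ∃ (e : Vec d) (φ : Vec d → ℝ) (K : NNReal) (U : Set (Vec d)),
    ‖e‖ = 1 ∧ LipschitzWith K φ ∧ IsOpen U ∧ x ∈ U ∧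
      ∀ y ∈ U, y ∈ Ω ↔ inner ℝ e y < φ (y - inner ℝ e y • e)

/-- `n` is the outer unit normal of `Ω` at the boundary point `x`: to first order at `x`, the set
`Ω` is the half space `{y | ⟪y - x, n⟫ < 0}`. (For a set with Lipschitz boundary, such an `n`
exists at almost every boundary point; for a `C¹` boundary it exists at all of them.) -/
def IsOuterUnitNormal {d : ℕ} (Ω : Set (Vec d)) (x n : Vec d) : Prop :=
  ‖n‖ = 1 ∧ ∀ ε > 0, ∀ᶠ y in 𝓝 x,
    (inner ℝ (y - x) n < -(ε * ‖y - x‖) → y ∈ Ω) ∧ (ε * ‖y - x‖ < inner ℝ (y - x) n → y ∉ Ω)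

open Classical in
/-- The outer unit normal of `Ω` at `x` (the zero vector where there is none). -/
def outerNormal {d : ℕ} (Ω : Set (Vec d)) (x : Vec d) : Vec d :=
  if h : ∃ n, IsOuterUnitNormal Ω x n then h.choose else 0

/-- The surface measure `dS` on `∂Ω`: the `(d-1)`-dimensional Hausdorff measure, normalised so that
it is the Lebesgue measure on hyperplanes. -/
def surfaceMeasure {d : ℕ} (Ω : Set (Vec d)) : Measure (Vec d) :=
  (Measure.euclideanHausdorffMeasure (d - 1)).restrict (frontier Ω)

/-! ### Differential operators in space -/

/-- The partial derivative `∂ᵢ f (x)`. -/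
def pd {d : ℕ} (i : Fin d) (f : Vec d → ℝ) (x : Vec d) : ℝ :=
  fderiv ℝ f x (EuclideanSpace.single i 1)

/-- The divergence of a vector field. -/
def divg {d : ℕ} (w : Vec d → Vec d) (x : Vec d) : ℝ :=
  ∑ i, pd i (fun y => w y i) x

/-- The (row-wise) divergence of a matrix field. -/
def matDiv {d : ℕ} (A : Vec d → Matrix (Fin d) (Fin d) ℝ) (x : Vec d) : Vec d :=
  WithLp.toLp 2 fun i => ∑ j, pd j (fun y => A y i j) x

/-- The strain rate `D = (∇u + (∇u)ᵀ) / 2`. -/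
def strain {d : ℕ} (u : Vec d → Vec d) (x : Vec d) : Matrix (Fin d) (Fin d) ℝ :=
  Matrix.of fun i j => (pd i (fun y => u y j) x + pd j (fun y => u y i) x) / 2

/-- The tensor product `a ⊗ b`. -/
def tensor {d : ℕ} (a b : Vec d) : Matrix (Fin d) (Fin d) ℝ :=
  Matrix.of fun i j => a i * b j

/-! ### Constitutive relations -/

/-- The coefficients of the model. -/
structure Params where
  /-- density of the pure phase 1 -/
  rho1 : ℝ
  /-- density of the pure phase 2 -/
  rho2 : ℝ
  /-- viscosity of the pure phase 1 -/
  eta1 : ℝ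
  /-- viscosity of the pure phase 2 -/
  eta2 : ℝ
  /-- wall friction coefficient of the pure phase 1 -/
  beta1 : ℝ
  /-- wall friction coefficient of the pure phase 2 -/
  beta2 : ℝ
  /-- mixing energy density `λ_c` -/
  lamC : ℝ
  /-- capillary width `γ` of the interface -/
  gam : ℝ
  /-- surface tension `σ` -/
  sig : ℝ
  /-- static contact angle `θ_s` -/
  theta : ℝ
  /-- second Lamé coefficient `λ(c)` -/
  lam : ℝ → ℝ
  /-- bulk mobility `M(c)` -/
  mob : ℝ → ℝ
  /-- wall mobility `M_Γ(c)` -/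
  mobW : ℝ → ℝ
  rho1_pos : 0 < rho1
  rho2_pos : 0 < rho2
  eta1_pos : 0 < eta1
  eta2_pos : 0 < eta2
  beta1_pos : 0 < beta1
  beta2_pos : 0 < beta2

namespace Params

variable (P : Params)

/-- The mixture density: `1/ρ(c) = c/ρ₁ + (1-c)/ρ₂`. -/
def rho (s : ℝ) : ℝ := (s / P.rho1 + (1 - s) / P.rho2)⁻¹

/-- The viscosity: `1/η(c) = c/η₁ + (1-c)/η₂`. -/
def eta (s : ℝ) : ℝ := (s / P.eta1 + (1 - s) / P.eta2)⁻¹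

/-- The wall friction coefficient: `1/β_Γ(c) = c/β_Γ₁ + (1-c)/β_Γ₂`. -/
def beta (s : ℝ) : ℝ := (s / P.beta1 + (1 - s) / P.beta2)⁻¹

/-- `α = (ρ₂ - ρ₁) / (ρ₁ ρ₂)`. -/
def alpha : ℝ := (P.rho2 - P.rho1) / (P.rho1 * P.rho2)

/-- The wall energy density `f_w(c) = -(σ/2) cos θ_s sin((2c-1)π/2)`. -/
def fw (s : ℝ) : ℝ :=
  -(P.sig / 2) * Real.cos P.theta * Real.sin ((2 * s - 1) * Real.pi / 2)

end Params

/-- The bulk energy density `G(c) = c²(1-c)²/4`. -/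
def bulkG (s : ℝ) : ℝ := s ^ 2 * (1 - s) ^ 2 / 4

/-! ### The fields of the model. Here `c, u, p` are the phase field, velocity and pressure. -/

section Fields

variable {d : ℕ} (P : Params)

/-- The material derivative `Df/Dt = ∂_t f + (u·∇) f` of a scalar or vector field `f`. -/
def matDeriv {F : Type*} [NormedAddCommGroup F] [NormedSpace ℝ F]
    (u : ℝ → Vec d → Vec d) (f : ℝ → Vec d → F) (t : ℝ) (x : Vec d) : F :=
  deriv (fun s => f s x) t + fderiv ℝ (f t) x (u t x)

/-- The chemical potential `μ̃ = λ_c G'(c) - (λ_c γ²/ρ) ∇·(ρ∇c) + α p`. -/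
def chemPot (c p : ℝ → Vec d → ℝ) (t : ℝ) (x : Vec d) : ℝ :=
  P.lamC * deriv bulkG (c t x)
    - P.lamC * P.gam ^ 2 / P.rho (c t x)
        * divg (fun y => P.rho (c t y) • gradient (c t) y) x
    + P.alpha * p t x

/-- The viscous stress `σ_η = 2ηD + λ(∇·u) I - p I`. -/
def viscStress (c : ℝ → Vec d → ℝ) (u : ℝ → Vec d → Vec d) (p : ℝ → Vec d → ℝ)
    (t : ℝ) (x : Vec d) : Matrix (Fin d) (Fin d) ℝ :=
  (2 * P.eta (c t x)) • strain (u t) x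
    + (P.lam (c t x) * divg (u t) x) • (1 : Matrix (Fin d) (Fin d) ℝ)
    - p t x • (1 : Matrix (Fin d) (Fin d) ℝ)

/-- `L(c) = ρ λ_c γ² ∂_n c + f_w'(c)` at a boundary point with normal `n`. -/
def wallL (c : ℝ → Vec d → ℝ) (n : Vec d) (t : ℝ) (x : Vec d) : ℝ :=
  P.rho (c t x) * P.lamC * P.gam ^ 2 * inner ℝ n (gradient (c t) x) + deriv P.fw (c t x)

/-- The surface gradient `∇_Γ f = ∇f - n (n·∇f)`. -/
def surfGrad (f : Vec d → ℝ) (n x : Vec d) : Vec d :=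
  gradient f x - inner ℝ n (gradient f x) • n

/-- The surface material derivative `D_Γ c/Dt = ∂_t c + u·∇_Γ c`. -/
def surfMatDeriv (u : ℝ → Vec d → Vec d) (c : ℝ → Vec d → ℝ) (n : Vec d)
    (t : ℝ) (x : Vec d) : ℝ :=
  deriv (fun s => c s x) t + inner ℝ (u t x) (surfGrad (c t) n x)

/-- The slip velocity `u^s = u_τ = u - (u·n) n` relative to the fixed wall. -/
def slipVel (u : ℝ → Vec d → Vec d) (n : Vec d) (t : ℝ) (x : Vec d) : Vec d :=
  u t x - inner ℝ (u t x) n • n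

/-- `f` is smooth on `J × closure Ω`, up to the boundary (it is defined and smooth around
each of the points of this set). -/
def SmoothUpToBoundary {F : Type*} [NormedAddCommGroup F] [NormedSpace ℝ F]
    (J : Set ℝ) (Ω : Set (Vec d)) (f : ℝ → Vec d → F) : Prop :=
  ∀ t ∈ J, ∀ x ∈ closure Ω, ContDiffAt ℝ ∞ (fun q : ℝ × Vec d => f q.1 q.2) (t, x)

/-- `(c, u, p)` is a smooth solution, for the times in `J`, of the quasi-incompressible
Navier-Stokes-Cahn-Hilliard system in `Ω` with the generalized Navier boundary condition and the
Allen-Cahn type condition on the wall `∂Ω`. The boundary conditions are imposed wherever `∂Ω` has a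
normal. -/
structure IsSmoothSolution (Ω : Set (Vec d)) (J : Set ℝ)
    (c : ℝ → Vec d → ℝ) (u : ℝ → Vec d → Vec d) (p : ℝ → Vec d → ℝ) : Prop where
  smooth_c : SmoothUpToBoundary J Ω c
  smooth_u : SmoothUpToBoundary J Ω u
  smooth_p : SmoothUpToBoundary J Ω p
  /-- the coefficient functions are smooth at the values that `c` takes -/
  smooth_lam : ∀ t ∈ J, ∀ x ∈ closure Ω, ContDiffAt ℝ ∞ P.lam (c t x)
  smooth_mob : ∀ t ∈ J, ∀ x ∈ closure Ω, ContDiffAt ℝ ∞ P.mob (c t x)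
  smooth_mobW : ∀ t ∈ J, ∀ x ∈ frontier Ω, ContDiffAt ℝ ∞ P.mobW (c t x)
  /-- density, viscosity and wall friction are well defined and positive -/
  rho_pos : ∀ t ∈ J, ∀ x ∈ closure Ω, 0 < P.rho (c t x)
  eta_pos : ∀ t ∈ J, ∀ x ∈ closure Ω, 0 < P.eta (c t x)
  beta_pos : ∀ t ∈ J, ∀ x ∈ frontier Ω, 0 < P.beta (c t x)
  /-- `ρ Dc/Dt = ∇·(M ∇μ̃)` -/
  phase_eq : ∀ t ∈ J, ∀ x ∈ Ω,
    P.rho (c t x) * matDeriv u c t x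
      = divg (fun y => P.mob (c t y) • gradient (chemPot P c p t) y) x
  /-- `Dρ/Dt + ρ ∇·u = 0` -/
  mass_eq : ∀ t ∈ J, ∀ x ∈ Ω,
    matDeriv u (fun s y => P.rho (c s y)) t x + P.rho (c t x) * divg (u t) x = 0
  /-- `ρ Du/Dt = ∇·(2ηD) + ∇(λ ∇·u) - ∇p - ∇·(λ_c γ² ρ ∇c ⊗ ∇c)` -/
  momentum_eq : ∀ t ∈ J, ∀ x ∈ Ω,
    P.rho (c t x) • matDeriv u u t x
      = matDiv (fun y => (2 * P.eta (c t y)) • strain (u t) y) x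
        + gradient (fun y => P.lam (c t y) * divg (u t) y) x
        - gradient (p t) x
        - matDiv (fun y => (P.lamC * P.gam ^ 2 * P.rho (c t y)) •
            tensor (gradient (c t) y) (gradient (c t) y)) x
  /-- `D_Γ c/Dt = -M_Γ L(c)` -/
  wall_phase : ∀ t ∈ J, ∀ x ∈ frontier Ω, ∀ n, IsOuterUnitNormal Ω x n →
    surfMatDeriv u c n t x = -(P.mobW (c t x) * wallL P c n t x)
  /-- `∇μ̃ · n = 0` -/
  wall_flux : ∀ t ∈ J, ∀ x ∈ frontier Ω, ∀ n, IsOuterUnitNormal Ω x n →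
    inner ℝ (gradient (chemPot P c p t) x) n = 0
  /-- `u · n = 0` -/
  wall_normal : ∀ t ∈ J, ∀ x ∈ frontier Ω, ∀ n, IsOuterUnitNormal Ω x n →
    inner ℝ (u t x) n = 0
  /-- `u^s · τ = β_Γ⁻¹ (-(n · σ_η · τ) + L(c) ∂_τ c)` for all tangent vectors `τ` -/
  wall_slip : ∀ t ∈ J, ∀ x ∈ frontier Ω, ∀ n, IsOuterUnitNormal Ω x n →
    ∀ τ : Vec d, inner ℝ τ n = 0 →
      inner ℝ (slipVel u n t x) τ
        = (P.beta (c t x))⁻¹ *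
          (-(n.ofLp ⬝ᵥ (viscStress P c u p t x *ᵥ τ.ofLp))
            + wallL P c n t x * inner ℝ τ (gradient (c t) x))

/-! ### Energy and dissipation densities -/

/-- `ρ|u|²/2` -/
def kinDensity (c : ℝ → Vec d → ℝ) (u : ℝ → Vec d → Vec d) (t : ℝ) (x : Vec d) : ℝ :=
  P.rho (c t x) * ‖u t x‖ ^ 2 / 2

/-- `λ_c ρ (G(c) + (γ²/2)|∇c|²)` -/
def mixDensity (c : ℝ → Vec d → ℝ) (t : ℝ) (x : Vec d) : ℝ :=
  P.lamC * P.rho (c t x) * (bulkG (c t x) + P.gam ^ 2 / 2 * ‖gradient (c t) x‖ ^ 2)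

/-- `E_tot = ∫_Ω ρ|u|²/2 + ∫_Ω λ_c ρ (G(c) + (γ²/2)|∇c|²) + ∫_∂Ω f_w(c) dS` -/
def totalEnergy (Ω : Set (Vec d)) (c : ℝ → Vec d → ℝ) (u : ℝ → Vec d → Vec d) (t : ℝ) : ℝ :=
  (∫ x in Ω, kinDensity P c u t x) + (∫ x in Ω, mixDensity P c t x)
    + ∫ x, P.fw (c t x) ∂(surfaceMeasure Ω)

/-- `2η|D|²` with the Frobenius norm of `D` -/
def shearDissip (c : ℝ → Vec d → ℝ) (u : ℝ → Vec d → Vec d) (t : ℝ) (x : Vec d) : ℝ :=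
  2 * P.eta (c t x) * ∑ i, ∑ j, strain (u t) x i j ^ 2

/-- `λ|∇·u|²` -/
def bulkDissip (c : ℝ → Vec d → ℝ) (u : ℝ → Vec d → Vec d) (t : ℝ) (x : Vec d) : ℝ :=
  P.lam (c t x) * divg (u t) x ^ 2

/-- `M|∇μ̃|²` -/
def diffDissip (c p : ℝ → Vec d → ℝ) (t : ℝ) (x : Vec d) : ℝ :=
  P.mob (c t x) * ‖gradient (chemPot P c p t) x‖ ^ 2

/-- `M_Γ|L(c)|² + β_Γ|u^s|²` on `∂Ω` -/
def wallDissip (Ω : Set (Vec d)) (c : ℝ → Vec d → ℝ) (u : ℝ → Vec d → Vec d)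
    (t : ℝ) (x : Vec d) : ℝ :=
  P.mobW (c t x) * wallL P c (outerNormal Ω x) t x ^ 2
    + P.beta (c t x) * ‖slipVel u (outerNormal Ω x) t x‖ ^ 2

end Fields

end QNSCH

end

/-!
The proof has a geometric half and a computational half.

**Geometry.** The theorem rests on the divergence theorem `∫_Ω div w = ∫_∂Ω w · n dS` on a bounded
Lipschitz domain, with the Hausdorff measure on the boundary (`IsLipschitzDomain.setIntegral_divg`).
A smooth partition of unity reduces it to functions supported inside `Ω`, where the integral of a
derivative vanishes, and to functions supported where `Ω` lies below the graph of a Lipschitz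
function `φ` on a hyperplane `eᗮ`. In the volume preserving coordinates `(x, s) ↦ x + (φ x + s) e`
the graph becomes flat; at fixed `s`, the derivatives along the hyperplane of the (Lipschitz)
transported function integrate to zero, so that a directional derivative may be replaced by a
multiple of the vertical one, which is integrated in `s` (`setIntegral_subgraph_fderiv`). This gives
the integral of `g (⟪e, v⟫ - φ'(v))` over the hyperplane. The area formula for Lipschitz graphs
(`restrict_range_graphMap`) turns it into a surface integral: up to countably many pieces and a null
set, the graph is, with distortion close to `1`, that of a linear function, whose area factor
`√(1 + |∇φ|²)` is a determinant. Over the points of differentiability of `φ`, which by Rademacher's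
theorem are almost all, the outer normal exists and is the normal of the graph
(`IsGraphPatch.isOuterUnitNormal`), and outer normals are unique.

**Energy.** The density `e = ρ|u|²/2 + λ_c ρ (G(c) + (γ²/2)|∇c|²)` satisfies in `Ω` the local
balance `∂ₜ e = div F - 2η|D|² - λ(div u)² - M|∇μ̃|²` (`IsSmoothSolution.energy_balance`) with the
flux `F = 2ηDu + λ(div u)u - pu - λ_c γ² ρ (u·∇c)∇c + λ_c γ² ρ (Dc/Dt)∇c + M μ̃ ∇μ̃ - e u`.
Conservation of mass gives `div u = αρ Dc/Dt`, which cancels the work of the pressure against the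
term `αp` of the chemical potential, and the commutator of `D/Dt` with `∇` cancels the work of the
capillary stress. On the wall, the boundary conditions give
`F · n + ∂ₜ f_w(c) = -M_Γ L² - β_Γ |u^s|²` (`IsSmoothSolution.wall_balance`). Differentiation under
the integral sign and the divergence theorem applied to `F` conclude.
-/

noncomputable section

namespace QNSCH

/-! ### The area formula for Lipschitz graphs -/

section Graph

variable {E : Type*} [NormedAddCommGroup E] [InnerProductSpace ℝ E]

/-- The point of `E` over `x ∈ eᗮ` at height `s` in the vertical direction `e`. -/
def vert (e : E) (x : (ℝ ∙ e)ᗮ) (s : ℝ) : E := (x : E) + s • e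

/-- The parametrisation `x ↦ x + φ x • e` of the graph of `φ : eᗮ → ℝ`. -/
def graphMap (e : E) (φ : (ℝ ∙ e)ᗮ → ℝ) (x : (ℝ ∙ e)ᗮ) : E := vert e x (φ x)

/-- The linear parametrisation `x ↦ x + a x • e` of the hyperplane with slope `a`. -/
def linGraph (e : E) (a : (ℝ ∙ e)ᗮ →L[ℝ] ℝ) : (ℝ ∙ e)ᗮ →ₗ[ℝ] E :=
  (ℝ ∙ e)ᗮ.subtype + (a : (ℝ ∙ e)ᗮ →ₗ[ℝ] ℝ).smulRight e

theorem linGraph_apply (e : E) (a : (ℝ ∙ e)ᗮ →L[ℝ] ℝ) (x : (ℝ ∙ e)ᗮ) :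
    linGraph e a x = vert e x (a x) := by
  simp [linGraph, vert]

/-- The ratio `√(1 + |a|²)` of surface to horizontal area on the graph of a linear form `a`; for the
graph of a function it is taken at its derivative. -/
def areaFactor {H : Type*} [NormedAddCommGroup H] [NormedSpace ℝ H]
    (a : H →L[ℝ] ℝ) : ℝ := √(1 + ‖a‖ ^ 2)

theorem areaFactor_pos {H : Type*} [NormedAddCommGroup H] [NormedSpace ℝ H]
    (a : H →L[ℝ] ℝ) : 0 < areaFactor a := by
  unfold areaFactor; positivity

theorem one_le_areaFactor {H : Type*} [NormedAddCommGroup H] [NormedSpace ℝ H]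
    (a : H →L[ℝ] ℝ) : 1 ≤ areaFactor a := by
  unfold areaFactor
  rw [Real.one_le_sqrt]; nlinarith [sq_nonneg ‖a‖]

theorem continuous_areaFactor {H : Type*} [NormedAddCommGroup H] [NormedSpace ℝ H] :
    Continuous (areaFactor (H := H)) := by
  unfold areaFactor; fun_prop

theorem areaFactor_le_add {H : Type*} [NormedAddCommGroup H] [NormedSpace ℝ H]
    (a b : H →L[ℝ] ℝ) : areaFactor a ≤ areaFactor b + ‖a - b‖ := by
  have hb := one_le_areaFactor b
  have hb2 : areaFactor b ^ 2 = 1 + ‖b‖ ^ 2 := Real.sq_sqrt (by positivity)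
  have hb3 : ‖b‖ ≤ areaFactor b := by
    apply Real.le_sqrt_of_sq_le; linarith
  have h1 : ‖a‖ ≤ ‖b‖ + ‖a - b‖ := by
    have := norm_add_le b (a - b); rwa [add_sub_cancel] at this
  conv_lhs => unfold areaFactor
  rw [Real.sqrt_le_left (by positivity)]
  have h2 : ‖a‖ ^ 2 ≤ (‖b‖ + ‖a - b‖) ^ 2 := by gcongr
  nlinarith [norm_nonneg (a - b), mul_le_mul_of_nonneg_right hb3 (norm_nonneg (a - b))]

variable {e : E}

theorem inner_vert_right (he : ‖e‖ = 1) (x : (ℝ ∙ e)ᗮ) (s : ℝ) :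
    inner ℝ e (vert e x s) = s := by
  have hx : inner ℝ e (x : E) = 0 := Submodule.mem_orthogonal_singleton_iff_inner_right.1 x.2
  simp [vert, inner_add_right, hx, inner_smul_right, he]

theorem inner_vert_vert (he : ‖e‖ = 1) (x y : (ℝ ∙ e)ᗮ) (s r : ℝ) :
    inner ℝ (vert e x s) (vert e y r) = inner ℝ x y + s * r := by
  have hx : inner ℝ e (x : E) = 0 := Submodule.mem_orthogonal_singleton_iff_inner_right.1 x.2
  have hy : inner ℝ e (y : E) = 0 := Submodule.mem_orthogonal_singleton_iff_inner_right.1 y.2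
  have hx' : inner ℝ (x : E) e = 0 := by rw [real_inner_comm, hx]
  simp [vert, inner_add_left, inner_add_right, inner_smul_left, inner_smul_right, hx', hy, he,
    mul_comm]

theorem norm_vert_sq (he : ‖e‖ = 1) (x : (ℝ ∙ e)ᗮ) (s : ℝ) :
    ‖vert e x s‖ ^ 2 = ‖x‖ ^ 2 + s ^ 2 := by
  rw [← real_inner_self_eq_norm_sq, inner_vert_vert he, real_inner_self_eq_norm_sq]; ring

theorem vert_sub (x y : (ℝ ∙ e)ᗮ) (s r : ℝ) :
    vert e x s - vert e y r = vert e (x - y) (s - r) := by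
  simp only [vert, Submodule.coe_sub, sub_smul]; abel

theorem norm_le_norm_vert (he : ‖e‖ = 1) (x : (ℝ ∙ e)ᗮ) (s : ℝ) : ‖x‖ ≤ ‖vert e x s‖ := by
  apply (sq_le_sq₀ (norm_nonneg _) (norm_nonneg _)).1
  rw [norm_vert_sq he]; nlinarith [sq_nonneg s]

theorem norm_vert_le_add (he : ‖e‖ = 1) (x : (ℝ ∙ e)ᗮ) (s r : ℝ) :
    ‖vert e x s‖ ≤ ‖vert e x r‖ + |s - r| := by
  have : vert e x s = vert e x r + (s - r) • e := by simp only [vert, sub_smul]; abel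
  rw [this]
  refine (norm_add_le _ _).trans ?_
  simp [norm_smul, he]

/-- The squared volume factor of the linear graph is a rank one perturbation of the identity. -/
theorem normDet_linGraph [FiniteDimensional ℝ E] (he : ‖e‖ = 1) (a : (ℝ ∙ e)ᗮ →L[ℝ] ℝ) :
    (linGraph e a).normDet = areaFactor a := by
  have hn := (linGraph e a).normDet_nonneg
  rw [areaFactor, eq_comm, Real.sqrt_eq_iff_eq_sq (by positivity) hn]
  set b := stdOrthonormalBasis ℝ (ℝ ∙ e)ᗮ
  have h1 := (linGraph e a).normDet_sq_eq_det_gram b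
  have h2 : Matrix.gram ℝ (fun i => linGraph e a (b i)) =
      1 + Matrix.replicateCol Unit (fun i => a (b i)) *
        Matrix.replicateRow Unit (fun i => a (b i)) := by
    ext i j
    simp [Matrix.gram_apply, linGraph_apply, inner_vert_vert he, Matrix.mul_apply,
      Matrix.one_apply, OrthonormalBasis.inner_eq_ite]
  rw [h2, Matrix.det_one_add_replicateCol_mul_replicateRow] at h1
  simp only [RCLike.ofReal_real_eq_id, id_eq] at h1
  rw [h1]
  congr 1
  obtain ⟨g, rfl⟩ := (InnerProductSpace.toDual ℝ (ℝ ∙ e)ᗮ).surjective a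
  rw [LinearIsometryEquiv.norm_map, ← b.sum_sq_norm_inner_left g]
  simp [dotProduct, ← sq]

end Graph

section Comparison

variable {X Y Z : Type*} [MetricSpace X] [MeasurableSpace X] [BorelSpace X]
  [MetricSpace Y] [MeasurableSpace Y] [BorelSpace Y]

/-- If distances of `f` are dominated by those of `g`, then so are the Hausdorff measures of their
images. -/
theorem euclideanHausdorffMeasure_image_le_of_dist_le {f : Z → X} {g : Z → Y} {s : Set Z}
    {K : NNReal} (h : ∀ x ∈ s, ∀ y ∈ s, dist (f x) (f y) ≤ K * dist (g x) (g y)) (n : ℕ) :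
    μHE[n] (f '' s) ≤ (K : ENNReal) ^ n * μHE[n] (g '' s) := by
  rcases s.eq_empty_or_nonempty with rfl | ⟨z, hz⟩
  · simp
  have : Nonempty Z := ⟨z⟩
  set k : Y → X := fun y => f (Function.invFunOn g s y) with hk
  have hinv : ∀ x ∈ s, k (g x) = f x := by
    intro x hx
    have h1 : Function.invFunOn g s (g x) ∈ s := Function.invFunOn_mem ⟨x, hx, rfl⟩
    have h2 : g (Function.invFunOn g s (g x)) = g x := Function.invFunOn_eq ⟨x, hx, rfl⟩
    have h3 := h _ h1 _ hx
    rw [h2, dist_self, mul_zero] at h3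
    exact dist_le_zero.1 h3
  have hL : LipschitzOnWith K k (g '' s) := by
    apply LipschitzOnWith.of_dist_le_mul
    rintro _ ⟨x, hx, rfl⟩ _ ⟨y, hy, rfl⟩
    rw [hinv x hx, hinv y hy]
    exact h x hx y hy
  have him : k '' (g '' s) = f '' s := by
    rw [image_image]; exact image_congr hinv
  have := hL.hausdorffMeasure_image_le (d := (n : ℝ)) (by positivity)
  rw [him, ENNReal.rpow_natCast] at this
  rw [Measure.euclideanHausdorffMeasure_def, Measure.euclideanHausdorffMeasure_def,
    Measure.smul_apply, Measure.smul_apply, mul_smul_comm]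
  gcongr

end Comparison

section Area

variable {E : Type*} [NormedAddCommGroup E] [InnerProductSpace ℝ E] {e : E}

theorem dist_graphMap_le (he : ‖e‖ = 1) {φ ψ : (ℝ ∙ e)ᗮ → ℝ} {x y : (ℝ ∙ e)ᗮ} {δ : NNReal}
    (h : |(φ x - φ y) - (ψ x - ψ y)| ≤ δ * ‖x - y‖) :
    dist (graphMap e φ x) (graphMap e φ y)
      ≤ (1 + δ : NNReal) * dist (graphMap e ψ x) (graphMap e ψ y) := by
  simp only [dist_eq_norm, graphMap, vert_sub]
  have h1 := norm_vert_le_add he (x - y) (φ x - φ y) (ψ x - ψ y)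
  have h2 := norm_le_norm_vert he (x - y) (ψ x - ψ y)
  have h3 : (δ : ℝ) * ‖x - y‖ ≤ δ * ‖vert e (x - y) (ψ x - ψ y)‖ := by gcongr
  push_cast
  linarith

theorem lipschitzWith_graphMap (he : ‖e‖ = 1) {φ : (ℝ ∙ e)ᗮ → ℝ} {K : NNReal}
    (hφ : LipschitzWith K φ) : LipschitzWith (1 + K) (graphMap e φ) := by
  apply LipschitzWith.of_dist_le_mul
  intro x y
  have h1 : |(φ x - φ y) - (0 - 0)| ≤ K * ‖x - y‖ := by
    simpa [← dist_eq_norm, Real.dist_eq] using hφ.dist_le_mul x y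
  have := dist_graphMap_le he (ψ := fun _ => 0) h1
  simpa [graphMap, vert, Subtype.dist_eq] using this

theorem antilipschitzWith_graphMap (he : ‖e‖ = 1) (φ : (ℝ ∙ e)ᗮ → ℝ) :
    AntilipschitzWith 1 (graphMap e φ) := by
  apply AntilipschitzWith.of_le_mul_dist
  intro x y
  simpa [dist_eq_norm, graphMap, vert_sub] using norm_le_norm_vert he (x - y) (φ x - φ y)

variable [FiniteDimensional ℝ E]

theorem isClosedEmbedding_graphMap (he : ‖e‖ = 1) {φ : (ℝ ∙ e)ᗮ → ℝ} {K : NNReal}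
    (hφ : LipschitzWith K φ) : IsClosedEmbedding (graphMap e φ) :=
  (antilipschitzWith_graphMap he φ).isClosedEmbedding
    (lipschitzWith_graphMap he hφ).uniformContinuous

variable [MeasurableSpace E] [BorelSpace E]

/-- The surface measure of the graph of `φ`, pulled back to the hyperplane `eᗮ`. -/
def graphMeasure (e : E) (φ : (ℝ ∙ e)ᗮ → ℝ) : Measure (ℝ ∙ e)ᗮ :=
  (μHE[Module.finrank ℝ (ℝ ∙ e)ᗮ] : Measure E).comap (graphMap e φ)

theorem graphMeasure_apply (he : ‖e‖ = 1) {φ : (ℝ ∙ e)ᗮ → ℝ} {K : NNReal}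
    (hφ : LipschitzWith K φ) (s : Set (ℝ ∙ e)ᗮ) :
    graphMeasure e φ s = μHE[Module.finrank ℝ (ℝ ∙ e)ᗮ] (graphMap e φ '' s) :=
  (isClosedEmbedding_graphMap he hφ).measurableEmbedding.comap_apply _ _

theorem graphMeasure_le (he : ‖e‖ = 1) {φ : (ℝ ∙ e)ᗮ → ℝ} {K : NNReal}
    (hφ : LipschitzWith K φ) (s : Set (ℝ ∙ e)ᗮ) :
    graphMeasure e φ s ≤ ((1 + K : NNReal) : ENNReal) ^ Module.finrank ℝ (ℝ ∙ e)ᗮ * volume s := by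
  rw [graphMeasure_apply he hφ, ← InnerProductSpace.euclideanHausdorffMeasure_eq_volume]
  conv_rhs => rw [← image_id s]
  exact euclideanHausdorffMeasure_image_le_of_dist_le
    (fun x _ y _ => (lipschitzWith_graphMap he hφ).dist_le_mul x y) _

theorem graphMeasure_absolutelyContinuous (he : ‖e‖ = 1) {φ : (ℝ ∙ e)ᗮ → ℝ} {K : NNReal}
    (hφ : LipschitzWith K φ) : graphMeasure e φ ≪ volume := by
  refine Measure.AbsolutelyContinuous.mk fun s _ hs => ?_
  have := graphMeasure_le he hφ s
  rw [hs, mul_zero] at this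
  exact le_antisymm this zero_le

/-- A real-valued function that is close to an affine function on `s` has a derivative close to its
slope at almost all points of `s`. -/
theorem ae_norm_fderiv_sub_le_of_approximatesLinearOn {H : Type*} [NormedAddCommGroup H]
    [NormedSpace ℝ H] [FiniteDimensional ℝ H] [Nontrivial H] [MeasurableSpace H] [BorelSpace H]
    (μ : Measure H) [μ.IsAddHaarMeasure]
    {φ : H → ℝ} {s : Set H} {a : H →L[ℝ] ℝ} {δ : NNReal} (hs : MeasurableSet s)
    (h : ApproximatesLinearOn φ a s δ) (hd : ∀ x ∈ s, DifferentiableAt ℝ φ x) :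
    ∀ᵐ x ∂(μ.restrict s), ‖fderiv ℝ φ x - a‖ ≤ δ := by
  obtain ⟨v, hv⟩ := exists_norm_eq H zero_le_one
  have key := ApproximatesLinearOn.norm_fderiv_sub_le μ
    (f := fun x => φ x • v) (A := a.smulRight v) (s := s) (δ := δ) ?_ hs
    (fun x => (fderiv ℝ φ x).smulRight v) ?_
  · filter_upwards [key] with x hx
    have : (fderiv ℝ φ x).smulRight v - a.smulRight v = (fderiv ℝ φ x - a).smulRight v := by
      ext y; simp [sub_smul]
    rw [this, ← NNReal.coe_le_coe, coe_nnnorm, ContinuousLinearMap.norm_smulRight_apply, hv,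
      mul_one] at hx
    exact hx
  · intro x hx y hy
    have := h x hx y hy
    simpa [← sub_smul, norm_smul, hv] using this
  · intro x hx
    exact ((hd x hx).hasFDerivAt.smul_const v).hasFDerivWithinAt

/-- On a set where `φ` is `δ`-close to an affine function, the surface measure of the graph agrees
with `∫ √(1 + |∇φ|²)` up to a factor `(1 + δ) ^ (n + 1)`. -/
theorem graphMeasure_comparison [Nontrivial (ℝ ∙ e)ᗮ] (he : ‖e‖ = 1) {φ : (ℝ ∙ e)ᗮ → ℝ}
    {K : NNReal} (hφ : LipschitzWith K φ) {s : Set (ℝ ∙ e)ᗮ} (hs : MeasurableSet s)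
    (hd : ∀ x ∈ s, DifferentiableAt ℝ φ x) {a : (ℝ ∙ e)ᗮ →L[ℝ] ℝ} {δ : NNReal}
    (h : ApproximatesLinearOn φ a s δ) :
    graphMeasure e φ s ≤ ((1 + δ : NNReal) : ENNReal) ^ (Module.finrank ℝ (ℝ ∙ e)ᗮ + 1) *
        ∫⁻ x in s, ENNReal.ofReal (areaFactor (fderiv ℝ φ x)) ∧
    ∫⁻ x in s, ENNReal.ofReal (areaFactor (fderiv ℝ φ x)) ≤
      ((1 + δ : NNReal) : ENNReal) ^ (Module.finrank ℝ (ℝ ∙ e)ᗮ + 1) * graphMeasure e φ s := by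
  have hlin : linGraph e a '' s = graphMap e a '' s :=
    image_congr fun x _ => linGraph_apply e a x
  have hvol : μHE[Module.finrank ℝ (ℝ ∙ e)ᗮ] (graphMap e a '' s)
      = ENNReal.ofReal (areaFactor a) * volume s := by
    rw [← hlin, LinearMap.euclideanHausdorffMeasure_image_eq_normDet_mul_volume,
      normDet_linGraph he]
  have happ : ∀ x ∈ s, ∀ y ∈ s, |(φ x - φ y) - (a x - a y)| ≤ δ * ‖x - y‖ := by
    intro x hx y hy
    have := h x hx y hy
    rwa [map_sub, Real.norm_eq_abs] at this
  have happ' : ∀ x ∈ s, ∀ y ∈ s, |(a x - a y) - (φ x - φ y)| ≤ δ * ‖x - y‖ := by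
    intro x hx y hy
    rw [abs_sub_comm]; exact happ x hx y hy
  have h1 := euclideanHausdorffMeasure_image_le_of_dist_le
    (fun x hx y hy => dist_graphMap_le he (happ x hx y hy)) (Module.finrank ℝ (ℝ ∙ e)ᗮ)
  have h2 := euclideanHausdorffMeasure_image_le_of_dist_le
    (fun x hx y hy => dist_graphMap_le he (happ' x hx y hy)) (Module.finrank ℝ (ℝ ∙ e)ᗮ)
  rw [hvol, ← graphMeasure_apply he hφ] at h1 h2
  have hae := ae_norm_fderiv_sub_le_of_approximatesLinearOn volume hs h hd
  have hle : ∀ b c : (ℝ ∙ e)ᗮ →L[ℝ] ℝ, ‖b - c‖ ≤ δ → ENNReal.ofReal (areaFactor b) ≤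
      ((1 + δ : NNReal) : ENNReal) * ENNReal.ofReal (areaFactor c) := by
    intro b c hbc
    rw [← ENNReal.ofReal_coe_nnreal, ← ENNReal.ofReal_mul (by positivity)]
    apply ENNReal.ofReal_le_ofReal
    have := areaFactor_le_add b c
    have h1 := one_le_areaFactor c
    push_cast
    nlinarith [δ.2]
  have h3 : ENNReal.ofReal (areaFactor a) * volume s ≤
      ((1 + δ : NNReal) : ENNReal) * ∫⁻ x in s, ENNReal.ofReal (areaFactor (fderiv ℝ φ x)) := by
    rw [← setLIntegral_const, ← lintegral_const_mul' _ _ (by simp)]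
    apply lintegral_mono_ae
    filter_upwards [hae] with x hx
    exact hle _ _ ((norm_sub_rev a _).le.trans hx)
  have h4 : ∫⁻ x in s, ENNReal.ofReal (areaFactor (fderiv ℝ φ x)) ≤
      ((1 + δ : NNReal) : ENNReal) * (ENNReal.ofReal (areaFactor a) * volume s) := by
    rw [← setLIntegral_const, ← lintegral_const_mul' _ _ (by simp)]
    apply lintegral_mono_ae
    filter_upwards [hae] with x hx
    exact hle _ _ hx
  constructor
  · refine h1.trans ?_
    rw [pow_succ, mul_assoc]
    gcongr
  · refine h4.trans ?_
    rw [pow_succ', mul_assoc]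
    gcongr

/-- **Area formula for Lipschitz graphs**, for the measure of sets. -/
theorem graphMeasure_eq_withDensity [Nontrivial (ℝ ∙ e)ᗮ] (he : ‖e‖ = 1) {φ : (ℝ ∙ e)ᗮ → ℝ}
    {K : NNReal} (hφ : LipschitzWith K φ) :
    graphMeasure e φ =
      volume.withDensity fun x => ENNReal.ofReal (areaFactor (fderiv ℝ φ x)) := by
  set w : (ℝ ∙ e)ᗮ → ENNReal := fun x => ENNReal.ofReal (areaFactor (fderiv ℝ φ x)) with hw
  set n := Module.finrank ℝ (ℝ ∙ e)ᗮ with hn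
  set D : Set (ℝ ∙ e)ᗮ := {x | DifferentiableAt ℝ φ x} with hD
  have hDm : MeasurableSet D := measurableSet_of_differentiableAt ℝ φ
  have hD0 : volume Dᶜ = 0 := hφ.ae_differentiableAt
  -- on the countably many pieces where `φ` is `δ`-close to linear the measures are comparable
  have main : ∀ s, MeasurableSet s → ∀ δ : NNReal, 0 < δ →
      graphMeasure e φ s ≤ ((1 + δ : NNReal) : ENNReal) ^ (n + 1) * volume.withDensity w s ∧
      volume.withDensity w s ≤ ((1 + δ : NNReal) : ENNReal) ^ (n + 1) * graphMeasure e φ s := by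
    intro s hs δ hδ
    obtain ⟨t, A, tdisj, tmeas, tcov, tapp, -⟩ :=
      exists_partition_approximatesLinearOn_of_hasFDerivWithinAt φ D (fderiv ℝ φ)
        (fun x hx => (DifferentiableAt.hasFDerivAt hx).hasFDerivWithinAt) (fun _ => δ)
        (fun _ => hδ.ne')
    have hdec : ∀ ν : Measure (ℝ ∙ e)ᗮ, ν ≪ volume → ν s = ∑' k, ν (s ∩ (D ∩ t k)) := by
      intro ν hν
      rw [← measure_iUnion]
      · rw [← inter_iUnion, ← inter_iUnion, inter_eq_left.2 tcov, measure_inter_conull (hν hD0)]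
      · intro i j hij
        exact (tdisj hij).mono (inter_subset_right.trans inter_subset_right)
          (inter_subset_right.trans inter_subset_right)
      · exact fun k => hs.inter (hDm.inter (tmeas k))
    have hpiece : ∀ k, _ := fun k => graphMeasure_comparison he hφ (s := s ∩ (D ∩ t k))
      (hs.inter (hDm.inter (tmeas k))) (fun x hx => hx.2.1)
      ((tapp k).mono_set inter_subset_right)
    rw [hdec _ (graphMeasure_absolutelyContinuous he hφ),
      hdec _ (withDensity_absolutelyContinuous _ _), ← ENNReal.tsum_mul_left,
      ← ENNReal.tsum_mul_left]
    constructor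
    · refine ENNReal.tsum_le_tsum fun k => ?_
      rw [withDensity_apply _ (hs.inter (hDm.inter (tmeas k)))]
      exact (hpiece k).1
    · refine ENNReal.tsum_le_tsum fun k => ?_
      rw [withDensity_apply _ (hs.inter (hDm.inter (tmeas k)))]
      exact (hpiece k).2
  -- then `δ → 0`
  have lim : ∀ a b : ENNReal,
      (∀ δ : NNReal, 0 < δ → a ≤ ((1 + δ : NNReal) : ENNReal) ^ (n + 1) * b) → a ≤ b := by
    intro a b hab
    have ht : Tendsto (fun δ : NNReal => ((1 + δ : NNReal) : ENNReal) ^ (n + 1) * b)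
        (𝓝[>] 0) (𝓝 (((1 + 0 : NNReal) : ENNReal) ^ (n + 1) * b)) := by
      apply ENNReal.Tendsto.mul_const _ (Or.inl (by simp))
      apply Tendsto.mono_left _ nhdsWithin_le_nhds
      apply Continuous.tendsto (f := fun δ : NNReal => ((1 + δ : NNReal) : ENNReal) ^ (n + 1))
      fun_prop
    rw [add_zero, ENNReal.coe_one, one_pow, one_mul] at ht
    apply ge_of_tendsto ht
    filter_upwards [self_mem_nhdsWithin] with δ hδ using hab δ hδ
  ext s hs
  exact le_antisymm (lim _ _ fun δ hδ => (main s hs δ hδ).1)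
    (lim _ _ fun δ hδ => (main s hs δ hδ).2)

/-- **Area formula for Lipschitz graphs**: the surface measure of the graph of `φ` is the image of
the measure with density `√(1 + |∇φ|²)`. -/
theorem restrict_range_graphMap [Nontrivial (ℝ ∙ e)ᗮ] (he : ‖e‖ = 1) {φ : (ℝ ∙ e)ᗮ → ℝ}
    {K : NNReal} (hφ : LipschitzWith K φ) :
    (μHE[Module.finrank ℝ (ℝ ∙ e)ᗮ] : Measure E).restrict (range (graphMap e φ)) =
      (volume.withDensity fun x => ENNReal.ofReal (areaFactor (fderiv ℝ φ x))).map
        (graphMap e φ) := by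
  rw [← graphMeasure_eq_withDensity he hφ, graphMeasure,
    (isClosedEmbedding_graphMap he hφ).measurableEmbedding.map_comap]

end Area

/-! ### The divergence theorem below a Lipschitz graph -/

/-- The integral of a directional derivative of a compactly supported Lipschitz function
vanishes. -/
theorem integral_lineDeriv_eq_zero {H : Type*} [NormedAddCommGroup H] [NormedSpace ℝ H]
    [FiniteDimensional ℝ H] [MeasurableSpace H] [BorelSpace H] (μ : Measure H)
    [μ.IsAddHaarMeasure] {G : H → ℝ} {C : NNReal} (hG : LipschitzWith C G)
    (hc : HasCompactSupport G) (w : H) : ∫ x, lineDeriv ℝ G x w ∂μ = 0 := by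
  have h := LipschitzWith.integral_lineDeriv_mul_eq (μ := μ)
    (LipschitzWith.const (α := H) (1 : ℝ)) hG hc (-w)
  have h0 : ∀ x, lineDeriv ℝ (fun _ : H => (1 : ℝ)) x (-w) = 0 := by
    intro x; simp [lineDeriv]
  simpa [h0] using h.symm

section Vertical

variable {E : Type*} [NormedAddCommGroup E] [InnerProductSpace ℝ E] {e : E}

/-- The subgraph `{⟪e, y⟫ < φ}` of a function `φ`, with vertical direction `e`. -/
def subgraph (e : E) (φ : E → ℝ) : Set E := {y | inner ℝ e y < φ (y - inner ℝ e y • e)}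

theorem vert_mem_subgraph (he : ‖e‖ = 1) (φ : E → ℝ) (x : (ℝ ∙ e)ᗮ) (s : ℝ) :
    vert e x s ∈ subgraph e φ ↔ s < φ x := by
  have : vert e x s - s • e = x := by simp [vert]
  simp only [subgraph, mem_ofPred_eq, inner_vert_right he, this]

theorem exists_eq_vert (he : ‖e‖ = 1) (y : E) :
    ∃ x : (ℝ ∙ e)ᗮ, y = vert e x (inner ℝ e y) := by
  refine ⟨⟨y - inner ℝ e y • e, ?_⟩, by simp [vert]⟩
  rw [Submodule.mem_orthogonal_singleton_iff_inner_right]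
  simp [inner_sub_right, inner_smul_right, he]

theorem vert_injective (he : ‖e‖ = 1) :
    Function.Injective fun q : (ℝ ∙ e)ᗮ × ℝ => vert e q.1 q.2 := by
  rintro ⟨x, s⟩ ⟨y, r⟩ h
  have h1 : s = r := by
    rw [← inner_vert_right he x s, ← inner_vert_right he y r]; exact congrArg _ h
  subst h1
  have h2 : (x : E) = y := by simpa [vert] using h
  simp [Subtype.ext h2]

theorem continuous_vert (e : E) : Continuous fun q : (ℝ ∙ e)ᗮ × ℝ => vert e q.1 q.2 := by
  unfold vert; fun_prop

theorem integral_vertical_fderiv (he : ‖e‖ = 1) {g : E → ℝ} (hg : ContDiff ℝ 1 g)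
    (hc : HasCompactSupport g) (x : (ℝ ∙ e)ᗮ) (r : ℝ) :
    ∫ s in Iio 0, fderiv ℝ g (vert e x (r + s)) e = g (vert e x r) := by
  have hiso : Isometry fun s : ℝ => vert e x (r + s) := by
    apply Isometry.of_dist_eq
    intro s s'
    simp [dist_eq_norm, vert, ← sub_smul, norm_smul, he]
  have hcd : ContDiff ℝ 1 fun s : ℝ => vert e x (r + s) := by
    unfold vert; fun_prop
  have hderiv : ∀ s, deriv (fun s : ℝ => g (vert e x (r + s))) s =
      fderiv ℝ g (vert e x (r + s)) e := by
    intro s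
    have h1 : HasDerivAt (fun s : ℝ => vert e x (r + s)) e s := by
      have : HasDerivAt (fun s : ℝ => r + s) 1 s := (hasDerivAt_id s).const_add r
      simpa [vert] using (this.smul_const e).const_add (x : E)
    exact (((hg.differentiable one_ne_zero) _).hasFDerivAt.comp_hasDerivAt s h1).deriv
  rw [← integral_Iic_eq_integral_Iio, ← setIntegral_congr_fun measurableSet_Iic
    (fun s _ => hderiv s)]
  have := HasCompactSupport.integral_Iic_deriv_eq (hg.comp hcd)
    (hc.comp_isClosedEmbedding hiso.isClosedEmbedding) 0
  simpa [Function.comp_def] using this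

variable [FiniteDimensional ℝ E] [MeasurableSpace E] [BorelSpace E]

theorem measurePreserving_vert (he : ‖e‖ = 1) :
    MeasurePreserving (fun q : (ℝ ∙ e)ᗮ × ℝ => vert e q.1 q.2) := by
  have h1 : MeasurePreserving ((ℝ ∙ e).measurableEquivProd (0 : E)).symm := by
    have := ((ℝ ∙ e).measurePreserving_measurableEquivProd (0 : E)).symm
    rwa [InnerProductSpace.euclideanHausdorffMeasure_eq_volume] at this
  have h2 : MeasurePreserving (Prod.map (LinearIsometryEquiv.toSpanUnitSingleton (𝕜 := ℝ) e he)
      (id : (ℝ ∙ e)ᗮ → (ℝ ∙ e)ᗮ)) (volume.prod volume) (volume.prod volume) :=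
    (LinearIsometryEquiv.measurePreserving _).prod (MeasurePreserving.id _)
  have h3 : MeasurePreserving (Prod.swap : (ℝ ∙ e)ᗮ × ℝ → ℝ × (ℝ ∙ e)ᗮ) :=
    Measure.measurePreserving_swap
  convert h1.comp (h2.comp h3) using 1
  ext q
  simp [vert, add_comm]

/-- The coordinates `(x, s) ↦ x + (φ x + s) • e`, which straighten the graph of `φ`, preserve the
volume. -/
theorem measurePreserving_shear (he : ‖e‖ = 1) {φ : (ℝ ∙ e)ᗮ → ℝ} (hφ : Continuous φ) :
    MeasurePreserving (fun q : (ℝ ∙ e)ᗮ × ℝ => vert e q.1 (φ q.1 + q.2)) := by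
  have h : MeasurePreserving (fun q : (ℝ ∙ e)ᗮ × ℝ => (id q.1, φ q.1 + q.2)) :=
    (MeasurePreserving.id volume).skew_product (g := fun x s => φ x + s)
      (by fun_prop) (ae_of_all _ fun x => (measurePreserving_add_left volume (φ x)).map_eq)
  exact (measurePreserving_vert he).comp h

theorem measurableEmbedding_shear (he : ‖e‖ = 1) {φ : (ℝ ∙ e)ᗮ → ℝ} (hφ : Continuous φ) :
    MeasurableEmbedding (fun q : (ℝ ∙ e)ᗮ × ℝ => vert e q.1 (φ q.1 + q.2)) := by
  apply Continuous.measurableEmbedding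
  · exact (continuous_vert e).comp (by fun_prop : Continuous fun q : (ℝ ∙ e)ᗮ × ℝ =>
      (q.1, φ q.1 + q.2))
  · intro q q' h
    have h1 := vert_injective he (a₁ := (q.1, φ q.1 + q.2)) (a₂ := (q'.1, φ q'.1 + q'.2)) h
    rw [Prod.mk.injEq] at h1
    obtain ⟨h2, h3⟩ := h1
    rw [h2, add_right_inj] at h3
    exact Prod.ext h2 h3

/-- At fixed height above the graph, a directional derivative may be traded for a vertical
derivative, since the tangential derivatives integrate to zero. -/
theorem integral_fderiv_graphMap (he : ‖e‖ = 1) {φ : (ℝ ∙ e)ᗮ → ℝ} {K : NNReal}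
    (hφ : LipschitzWith K φ) {g : E → ℝ} (hg : ContDiff ℝ 1 g) (hc : HasCompactSupport g)
    (w : (ℝ ∙ e)ᗮ) (b : ℝ) :
    ∫ x, fderiv ℝ g (graphMap e φ x) (vert e w b) =
      ∫ x, (b - fderiv ℝ φ x w) * fderiv ℝ g (graphMap e φ x) e := by
  have hce := isClosedEmbedding_graphMap he hφ
  have hint : ∀ v : E, Integrable fun x => fderiv ℝ g (graphMap e φ x) v := by
    intro v
    apply Continuous.integrable_of_hasCompactSupport
    · exact ((hg.continuous_fderiv one_ne_zero).comp hce.continuous).clm_apply continuous_const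
    · exact (hc.fderiv_apply ℝ v).comp_isClosedEmbedding hce
  have hm : Integrable fun x => (b - fderiv ℝ φ x w) * fderiv ℝ g (graphMap e φ x) e := by
    apply (hint e).bdd_mul (c := |b| + K * ‖w‖)
    · exact ((measurable_const.sub (measurable_fderiv_apply_const ℝ φ w))).aestronglyMeasurable
    · refine ae_of_all _ fun x => ?_
      refine (norm_sub_le _ _).trans ?_
      gcongr
      · exact le_rfl
      · exact (ContinuousLinearMap.le_opNorm _ _).trans
          (by gcongr; exact norm_fderiv_le_of_lipschitz ℝ hφ)
  obtain ⟨C, hC⟩ := ContDiff.lipschitzWith_of_hasCompactSupport hc hg one_ne_zero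
  have hzero := integral_lineDeriv_eq_zero volume (hC.comp (lipschitzWith_graphMap he hφ))
    (hc.comp_isClosedEmbedding hce) w
  rw [← sub_eq_zero, ← integral_sub (hint _) hm, ← hzero]
  apply integral_congr_ae
  filter_upwards [hφ.ae_differentiableAt] with x hx
  have h1 : HasFDerivAt (graphMap e φ)
      ((ℝ ∙ e)ᗮ.subtypeL + (fderiv ℝ φ x).smulRight e) x :=
    ((ℝ ∙ e)ᗮ.subtypeL.hasFDerivAt).add (hx.hasFDerivAt.smul_const e)
  have h2 := ((hg.differentiable one_ne_zero) (graphMap e φ x)).hasFDerivAt.comp x h1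
  have h3 : lineDeriv ℝ (g ∘ graphMap e φ) x w =
      fderiv ℝ g (graphMap e φ x) ((w : E) + fderiv ℝ φ x w • e) := by
    rw [h2.differentiableAt.lineDeriv_eq_fderiv, h2.fderiv]
    simp
  rw [h3, vert]
  simp only [map_add, map_smul, smul_eq_mul]
  ring

/-- The divergence theorem for the subgraph of a Lipschitz function, in graph coordinates. -/
theorem setIntegral_subgraph_fderiv (he : ‖e‖ = 1) {φ : E → ℝ} {K : NNReal}
    (hφ : LipschitzWith K φ) {g : E → ℝ} (hg : ContDiff ℝ 1 g) (hc : HasCompactSupport g)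
    (w : (ℝ ∙ e)ᗮ) (b : ℝ) :
    ∫ y in subgraph e φ, fderiv ℝ g y (vert e w b) =
      ∫ x : (ℝ ∙ e)ᗮ, (b - fderiv ℝ (fun z : (ℝ ∙ e)ᗮ => φ z) x w) *
        g (graphMap e (fun z => φ z) x) := by
  set ψ : (ℝ ∙ e)ᗮ → ℝ := fun z => φ z with hψdef
  have hψ : LipschitzWith K ψ := by
    have := hφ.comp (ℝ ∙ e)ᗮ.subtypeₗᵢ.lipschitz
    rwa [mul_one] at this
  have hmp := measurePreserving_shear he hψ.continuous
  have hme := measurableEmbedding_shear he hψ.continuous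
  have hpre : (fun q : (ℝ ∙ e)ᗮ × ℝ => vert e q.1 (ψ q.1 + q.2)) ⁻¹' subgraph e φ
      = univ ×ˢ Iio 0 := by
    ext q
    simp [vert_mem_subgraph he, ψ]
  have hint : ∀ v : E, Integrable (fun q : (ℝ ∙ e)ᗮ × ℝ =>
      fderiv ℝ g (vert e q.1 (ψ q.1 + q.2)) v) (volume.prod volume) := by
    intro v
    refine hmp.integrable_comp_of_integrable (g := fun y => fderiv ℝ g y v) ?_
    exact ((hg.continuous_fderiv one_ne_zero).clm_apply
      continuous_const).integrable_of_hasCompactSupport (hc.fderiv_apply ℝ v)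
  have hm : Integrable (fun q : (ℝ ∙ e)ᗮ × ℝ =>
      (b - fderiv ℝ ψ q.1 w) * fderiv ℝ g (vert e q.1 (ψ q.1 + q.2)) e)
      (volume.prod volume) := by
    apply (hint e).bdd_mul (c := |b| + K * ‖w‖)
    · exact ((measurable_const.sub ((measurable_fderiv_apply_const ℝ ψ w).comp
        measurable_fst))).aestronglyMeasurable
    · refine ae_of_all _ fun q => ?_
      refine (norm_sub_le _ _).trans ?_
      gcongr
      · exact le_rfl
      · exact (ContinuousLinearMap.le_opNorm _ _).trans
          (by gcongr; exact norm_fderiv_le_of_lipschitz ℝ hψ)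
  have hslice : ∀ s : ℝ, ∫ x, fderiv ℝ g (vert e x (ψ x + s)) (vert e w b) =
      ∫ x, (b - fderiv ℝ ψ x w) * fderiv ℝ g (vert e x (ψ x + s)) e := by
    intro s
    have hs : LipschitzWith K fun x => ψ x + s := by
      simpa using hψ.add (LipschitzWith.const s)
    have := integral_fderiv_graphMap he hs hg hc w b
    simpa only [fderiv_add_const, graphMap] using this
  rw [← hmp.setIntegral_preimage_emb hme, hpre]
  have hv : (volume : Measure ((ℝ ∙ e)ᗮ × ℝ)) = volume.prod volume := rfl
  rw [hv, ← Measure.prod_restrict, Measure.restrict_univ]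
  have hres : ((volume : Measure (ℝ ∙ e)ᗮ).prod (volume.restrict (Iio (0 : ℝ)))) =
      (volume.prod volume).restrict (univ ×ˢ Iio 0) := by
    rw [← Measure.prod_restrict, Measure.restrict_univ]
  rw [integral_prod_symm _ (by rw [hres]; exact (hint _).restrict)]
  simp only [hslice]
  rw [← integral_integral_swap (f := fun x s => (b - fderiv ℝ ψ x w) *
    fderiv ℝ g (vert e x (ψ x + s)) e) (by rw [hres]; exact hm.restrict)]
  simp only [integral_const_mul, integral_vertical_fderiv he hg hc]
  rfl

/-- The upward unit normal of the graph of `ψ` over the point `x`. -/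
def graphNormal (e : E) (ψ : (ℝ ∙ e)ᗮ → ℝ) (x : (ℝ ∙ e)ᗮ) : E :=
  (areaFactor (fderiv ℝ ψ x))⁻¹ • vert e (-gradient ψ x) 1

/-- The divergence theorem for the subgraph of a Lipschitz function: `ν` is any field which is
the upward unit normal at almost all points of the graph. -/
theorem setIntegral_subgraph_fderiv_eq_surface [Nontrivial (ℝ ∙ e)ᗮ] (he : ‖e‖ = 1) {φ : E → ℝ}
    {K : NNReal} (hφ : LipschitzWith K φ) {g : E → ℝ} (hg : ContDiff ℝ 1 g)
    (hc : HasCompactSupport g) {ν : E → E}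
    (hν : ∀ x : (ℝ ∙ e)ᗮ, DifferentiableAt ℝ (fun z : (ℝ ∙ e)ᗮ => φ z) x →
      graphMap e (fun z => φ z) x ∈ tsupport g →
      ν (graphMap e (fun z => φ z) x) = graphNormal e (fun z => φ z) x) (v : E) :
    ∫ y in subgraph e φ, fderiv ℝ g y v =
      ∫ y in range (graphMap e (fun z => φ z)), g y * inner ℝ v (ν y)
        ∂(μHE[Module.finrank ℝ (ℝ ∙ e)ᗮ]) := by
  set ψ : (ℝ ∙ e)ᗮ → ℝ := fun z => φ z with hψdef
  have hψ : LipschitzWith K ψ := by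
    have := hφ.comp (ℝ ∙ e)ᗮ.subtypeₗᵢ.lipschitz
    rwa [mul_one] at this
  obtain ⟨w, hw⟩ := exists_eq_vert he v
  set b := inner ℝ e v with hb
  rw [hw, setIntegral_subgraph_fderiv he hφ hg hc, restrict_range_graphMap he hψ,
    (isClosedEmbedding_graphMap he hψ).measurableEmbedding.integral_map,
    integral_withDensity_eq_integral_toReal_smul₀]
  · apply integral_congr_ae
    filter_upwards [hψ.ae_differentiableAt] with x hx
    have hpos := areaFactor_pos (fderiv ℝ ψ x)
    rw [ENNReal.toReal_ofReal hpos.le, smul_eq_mul]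
    by_cases hxs : graphMap e ψ x ∈ tsupport g
    · rw [hν x hx hxs, graphNormal, inner_smul_right, inner_vert_vert he]
      have : inner ℝ w (-gradient ψ x) = - fderiv ℝ ψ x w := by
        rw [inner_neg_right, real_inner_comm, gradient, InnerProductSpace.toDual_symm_apply]
      rw [this]
      change (b - fderiv ℝ ψ x w) * g (graphMap e ψ x) = _
      field_simp
      ring
    · have : g (graphMap e (fun z => φ z) x) = 0 := image_eq_zero_of_notMem_tsupport hxs
      rw [this]; simp
  · exact (continuous_areaFactor.measurable.comp
      (measurable_fderiv ℝ ψ)).ennreal_ofReal.aemeasurable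
  · simp

end Vertical

/-! ### Outer normals and boundary patches -/

section Normal

variable {d : ℕ} {Ω : Set (Vec d)}

/-- Otherwise `x + t • (n - m)` would, for small `t > 0`, lie both in `Ω` and outside of it. -/
theorem IsOuterUnitNormal.unique {x n m : Vec d} (hn : IsOuterUnitNormal Ω x n)
    (hm : IsOuterUnitNormal Ω x m) : n = m := by
  by_contra hne
  have hpos : 0 < ‖n - m‖ := norm_pos_iff.2 (sub_ne_zero.2 hne)
  have hsq : ‖n - m‖ ^ 2 = 2 - 2 * inner ℝ n m := by
    rw [norm_sub_sq_real, hn.1, hm.1]; ring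
  have h1 : inner ℝ (n - m) n = ‖n - m‖ ^ 2 / 2 := by
    rw [inner_sub_left, real_inner_self_eq_norm_sq, hn.1, real_inner_comm, hsq]; ring
  have h2 : inner ℝ (n - m) m = -(‖n - m‖ ^ 2 / 2) := by
    rw [inner_sub_left, real_inner_self_eq_norm_sq, hm.1, hsq]; ring
  have hε : 0 < ‖n - m‖ / 4 := by positivity
  have hev := (hn.2 _ hε).and (hm.2 _ hε)
  have htend : Tendsto (fun t : ℝ => x + t • (n - m)) (𝓝[>] 0) (𝓝 x) := by
    apply Tendsto.mono_left _ nhdsWithin_le_nhds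
    have : Continuous fun t : ℝ => x + t • (n - m) := by fun_prop
    simpa using this.tendsto 0
  obtain ⟨t, ht, ht0⟩ := ((htend.eventually hev).and self_mem_nhdsWithin).exists
  have ht0 : 0 < t := ht0
  simp only [add_sub_cancel_left, inner_smul_left, norm_smul, Real.norm_eq_abs, abs_of_pos ht0,
    RCLike.conj_to_real, h1, h2] at ht
  refine ht.1.2 ?_ (ht.2.1 ?_)
  · nlinarith [mul_pos ht0 (pow_pos hpos 2)]
  · nlinarith [mul_pos ht0 (pow_pos hpos 2)]

theorem outerNormal_spec {x : Vec d} (h : ∃ n, IsOuterUnitNormal Ω x n) :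
    IsOuterUnitNormal Ω x (outerNormal Ω x) := by
  rw [outerNormal, dif_pos h]; exact h.choose_spec

theorem outerNormal_eq {x n : Vec d} (h : IsOuterUnitNormal Ω x n) : outerNormal Ω x = n :=
  (outerNormal_spec ⟨n, h⟩).unique h

theorem norm_outerNormal_le (Ω : Set (Vec d)) (x : Vec d) : ‖outerNormal Ω x‖ ≤ 1 := by
  by_cases h : ∃ n, IsOuterUnitNormal Ω x n
  · exact (outerNormal_spec h).1.le
  · simp [outerNormal, h]

theorem orthogonalProjectionOnto_vert {e : Vec d} (z : (ℝ ∙ e)ᗮ) (s : ℝ) :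
    (ℝ ∙ e)ᗮ.orthogonalProjectionOnto (vert e z s) = z := by
  simp [vert, Submodule.orthogonalProjectionOnto_orthogonalComplement_singleton_eq_zero]

/-- A boundary patch of `Ω`: in the open set `U`, the set `Ω` is the subgraph of the Lipschitz
function `φ` with vertical direction `e`. -/
structure IsGraphPatch (Ω : Set (Vec d)) (e : Vec d) (φ : Vec d → ℝ) (K : NNReal)
    (U : Set (Vec d)) : Prop where
  norm_eq : ‖e‖ = 1
  lipschitz : LipschitzWith K φ
  isOpen : IsOpen U
  mem_iff : ∀ y ∈ U, y ∈ Ω ↔ y ∈ subgraph e φ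

variable {e : Vec d} {φ : Vec d → ℝ} {K : NNReal} {U : Set (Vec d)}

theorem IsGraphPatch.lipschitz_restrict (h : IsGraphPatch Ω e φ K U) :
    LipschitzWith K fun z : (ℝ ∙ e)ᗮ => φ z := by
  have := h.lipschitz.comp (ℝ ∙ e)ᗮ.subtypeₗᵢ.lipschitz
  rwa [mul_one] at this

theorem isOpen_subgraph {e : Vec d} {φ : Vec d → ℝ} (hφ : Continuous φ) :
    IsOpen (subgraph e φ) :=
  isOpen_lt (by fun_prop) (by fun_prop)

theorem IsGraphPatch.mem_frontier_iff (h : IsGraphPatch Ω e φ K U) (hΩ : IsOpen Ω)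
    {y : Vec d} (hy : y ∈ U) :
    y ∈ frontier Ω ↔ y ∈ range (graphMap e fun z : (ℝ ∙ e)ᗮ => φ z) := by
  have he := h.norm_eq
  have hφ := h.lipschitz.continuous
  rw [hΩ.frontier_eq]
  constructor
  · rintro ⟨hcl, hnot⟩
    obtain ⟨x, hx⟩ := exists_eq_vert he y
    rw [h.mem_iff y hy, hx, vert_mem_subgraph he, not_lt] at hnot
    have h1 : y ∈ closure (U ∩ Ω) := h.isOpen.inter_closure ⟨hy, hcl⟩
    have h2 : closure (U ∩ Ω) ⊆ {y | inner ℝ e y ≤ φ (y - inner ℝ e y • e)} := by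
      apply closure_minimal
      · rintro z ⟨hzU, hzΩ⟩
        have hlt : inner ℝ e z < φ (z - inner ℝ e z • e) := (h.mem_iff z hzU).1 hzΩ
        exact hlt.le
      · exact isClosed_le (by fun_prop) (by fun_prop)
    have h3 : inner ℝ e y ≤ φ (y - inner ℝ e y • e) := h2 h1
    have h4 : y - inner ℝ e y • e = x := by
      nth_rewrite 1 [hx]; simp [vert]
    rw [h4] at h3
    exact ⟨x, by rw [graphMap, le_antisymm hnot h3, ← hx]⟩
  · rintro ⟨x, rfl⟩
    refine ⟨?_, ?_⟩
    · have htend : Tendsto (fun t : ℝ => vert e x (φ x - t)) (𝓝[>] 0)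
          (𝓝 (graphMap e (fun z : (ℝ ∙ e)ᗮ => φ z) x)) := by
        apply Tendsto.mono_left _ nhdsWithin_le_nhds
        have : Continuous fun t : ℝ => vert e x (φ x - t) := by unfold vert; fun_prop
        simpa [graphMap] using this.tendsto 0
      apply mem_closure_of_tendsto htend
      filter_upwards [htend.eventually (h.isOpen.mem_nhds hy), self_mem_nhdsWithin] with t ht ht0
      rw [h.mem_iff _ ht, vert_mem_subgraph he]
      have : 0 < t := ht0
      linarith
    · rw [h.mem_iff _ hy, graphMap, vert_mem_subgraph he]
      exact lt_irrefl _

/-- At a point of the graph over a point of differentiability of `φ`, the outer normal is the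
normal of the graph. -/
theorem IsGraphPatch.isOuterUnitNormal (h : IsGraphPatch Ω e φ K U) {x : (ℝ ∙ e)ᗮ}
    (hx : DifferentiableAt ℝ (fun z : (ℝ ∙ e)ᗮ => φ z) x)
    (hxU : graphMap e (fun z : (ℝ ∙ e)ᗮ => φ z) x ∈ U) :
    IsOuterUnitNormal Ω (graphMap e (fun z => φ z) x) (graphNormal e (fun z => φ z) x) := by
  have he := h.norm_eq
  set ψ : (ℝ ∙ e)ᗮ → ℝ := fun z => φ z with hψ
  have hw := areaFactor_pos (fderiv ℝ ψ x)
  have hw1 := one_le_areaFactor (fderiv ℝ ψ x)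
  have hgrad : ‖gradient ψ x‖ = ‖fderiv ℝ ψ x‖ := by
    rw [gradient, LinearIsometryEquiv.norm_map]
  refine ⟨?_, fun ε hε => ?_⟩
  · have h1 : ‖vert e (-gradient ψ x) 1‖ = areaFactor (fderiv ℝ ψ x) := by
      rw [areaFactor, eq_comm, Real.sqrt_eq_iff_eq_sq (by positivity) (norm_nonneg _),
        norm_vert_sq he, norm_neg, hgrad]
      ring
    rw [graphNormal, norm_smul, h1, norm_inv, Real.norm_of_nonneg hw.le, inv_mul_cancel₀ hw.ne']
  · have hlit := hx.hasFDerivAt.isLittleO.def (half_pos hε)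
    -- `pr` is the orthogonal projection onto the hyperplane of the base points
    set pr : Vec d → (ℝ ∙ e)ᗮ := fun y => (ℝ ∙ e)ᗮ.orthogonalProjectionOnto y with hpr
    have hprv : ∀ z s, pr (vert e z s) = z := orthogonalProjectionOnto_vert
    have hprt : Tendsto pr (𝓝 (graphMap e ψ x)) (𝓝 x) := by
      have : Continuous pr := by fun_prop
      have h1 := this.tendsto (graphMap e ψ x)
      rwa [graphMap, hprv] at h1
    filter_upwards [h.isOpen.mem_nhds hxU, hprt.eventually hlit] with y hyU hy
    obtain ⟨z, hz⟩ := exists_eq_vert he y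
    set s := inner ℝ e y with hs
    rw [hz, hprv] at hy
    rw [h.mem_iff y hyU, hz, vert_mem_subgraph he]
    have hsub : vert e z s - graphMap e ψ x = vert e (z - x) (s - ψ x) := by
      rw [graphMap, vert_sub]
    have hin : inner ℝ (vert e z s - graphMap e ψ x) (graphNormal e ψ x) =
        (areaFactor (fderiv ℝ ψ x))⁻¹ * ((s - ψ x) - fderiv ℝ ψ x (z - x)) := by
      rw [hsub, graphNormal, inner_smul_right, inner_vert_vert he, inner_neg_right,
        real_inner_comm, gradient, InnerProductSpace.toDual_symm_apply]
      ring
    have hle : ‖z - x‖ ≤ ‖vert e z s - graphMap e ψ x‖ := by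
      rw [hsub]; exact norm_le_norm_vert he _ _
    rw [hin]
    set N := ‖vert e z s - graphMap e ψ x‖ with hN
    have hN0 : 0 ≤ N := norm_nonneg _
    have hNpos : N ≠ 0 → 0 < N := fun h => lt_of_le_of_ne hN0 (Ne.symm h)
    rw [Real.norm_eq_abs, abs_le] at hy
    have hyN : ε / 2 * ‖z - x‖ ≤ ε / 2 * N := by gcongr
    have hwN : ε * N ≤ areaFactor (fderiv ℝ ψ x) * (ε * N) :=
      le_mul_of_one_le_left (by positivity) hw1
    have hεN : 0 ≤ ε * N := by positivity
    constructor
    · intro hlt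
      rw [inv_mul_lt_iff₀ hw] at hlt
      change s < ψ z
      nlinarith
    · intro hlt
      rw [lt_inv_mul_iff₀ hw] at hlt
      change ¬ s < ψ z
      nlinarith

end Normal

/-! ### The divergence theorem on Lipschitz domains -/

section Patch

variable {d : ℕ} {Ω : Set (Vec d)} {e : Vec d} {φ : Vec d → ℝ} {K : NNReal} {U : Set (Vec d)}

theorem finrank_orthogonal_singleton (hd : 1 ≤ d) (he : ‖e‖ = 1) :
    Module.finrank ℝ (ℝ ∙ e)ᗮ = d - 1 := by
  have : Fact (Module.finrank ℝ (Vec d) = (d - 1) + 1) := ⟨by simp; omega⟩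
  exact Submodule.finrank_orthogonal_span_singleton (by rintro rfl; simp at he)

theorem nontrivial_orthogonal_singleton (hd : 2 ≤ d) (he : ‖e‖ = 1) :
    Nontrivial (ℝ ∙ e)ᗮ := by
  apply Module.nontrivial_of_finrank_pos (R := ℝ)
  rw [finrank_orthogonal_singleton (by omega) he]; omega

/-- The divergence theorem for functions supported in a boundary patch. -/
theorem IsGraphPatch.setIntegral_fderiv (hd : 2 ≤ d) (h : IsGraphPatch Ω e φ K U)
    (hΩ : IsOpen Ω) {g : Vec d → ℝ} (hg : ContDiff ℝ 1 g) (hc : HasCompactSupport g)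
    (hgU : tsupport g ⊆ U) (v : Vec d) :
    ∫ y in Ω, fderiv ℝ g y v = ∫ y, g y * inner ℝ v (outerNormal Ω y) ∂(surfaceMeasure Ω) := by
  have := nontrivial_orthogonal_singleton hd h.norm_eq
  have key := setIntegral_subgraph_fderiv_eq_surface h.norm_eq h.lipschitz hg hc
    (ν := outerNormal Ω) (fun x hx hxg => outerNormal_eq (h.isOuterUnitNormal hx (hgU hxg))) v
  rw [finrank_orthogonal_singleton (by omega) h.norm_eq] at key
  have hcl := isClosedEmbedding_graphMap h.norm_eq h.lipschitz_restrict
  rw [surfaceMeasure]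
  convert key using 1
  · rw [← integral_indicator hΩ.measurableSet,
      ← integral_indicator (isOpen_subgraph h.lipschitz.continuous).measurableSet]
    congr 1
    ext y
    by_cases hy : y ∈ tsupport g
    · exact indicator_eq_indicator (h.mem_iff y (hgU hy)) rfl
    · have : fderiv ℝ g y = 0 := by
        by_contra hne
        exact hy (support_fderiv_subset ℝ hne)
      simp [indicator, this]
  · rw [← integral_indicator isClosed_frontier.measurableSet,
      ← integral_indicator hcl.isClosed_range.measurableSet]
    congr 1
    ext y
    by_cases hy : y ∈ tsupport g
    · exact indicator_eq_indicator (h.mem_frontier_iff hΩ (hgU hy)) rfl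
    · simp [indicator, image_eq_zero_of_notMem_tsupport hy]

/-- By Rademacher's theorem, almost all points of a boundary patch lie over a point of
differentiability. -/
theorem IsGraphPatch.ae_exists_eq_graphMap (hd : 2 ≤ d) (h : IsGraphPatch Ω e φ K U)
    (hΩ : IsOpen Ω) :
    ∀ᵐ y ∂(μHE[d - 1] : Measure (Vec d)), y ∈ U → y ∈ frontier Ω → ∃ x : (ℝ ∙ e)ᗮ,
      DifferentiableAt ℝ (fun z : (ℝ ∙ e)ᗮ => φ z) x ∧ graphMap e (fun z => φ z) x = y := by
  have hnull := graphMeasure_absolutelyContinuous h.norm_eq h.lipschitz_restrict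
    h.lipschitz_restrict.ae_differentiableAt
  rw [graphMeasure_apply h.norm_eq h.lipschitz_restrict,
    finrank_orthogonal_singleton (by omega) h.norm_eq] at hnull
  filter_upwards [measure_eq_zero_iff_ae_notMem.1 hnull] with y hy hyU hyf
  obtain ⟨x, rfl⟩ := (h.mem_frontier_iff hΩ hyU).1 hyf
  refine ⟨x, ?_, rfl⟩
  by_contra hx
  exact hy (mem_image_of_mem _ hx)

theorem measurable_graphNormal {e : Vec d} (ψ : (ℝ ∙ e)ᗮ → ℝ) : Measurable (graphNormal e ψ) := by
  have h1 : Measurable fun x => areaFactor (fderiv ℝ ψ x) :=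
    continuous_areaFactor.measurable.comp (measurable_fderiv ℝ ψ)
  have h2 : Measurable (gradient ψ) :=
    (InnerProductSpace.toDual ℝ (ℝ ∙ e)ᗮ).symm.continuous.measurable.comp (measurable_fderiv ℝ ψ)
  have h3 : Measurable fun x => vert e (-gradient ψ x) 1 :=
    (continuous_vert e).measurable.comp (h2.neg.prodMk measurable_const)
  exact h1.inv.smul h3

/-- On a patch the outer normal agrees almost everywhere with the normal of the graph, which is
measurable. -/
theorem IsGraphPatch.aemeasurable_outerNormal (hd : 2 ≤ d) (h : IsGraphPatch Ω e φ K U)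
    (hΩ : IsOpen Ω) :
    AEMeasurable (outerNormal Ω) ((μHE[d - 1]).restrict (frontier Ω ∩ U)) := by
  refine ⟨fun y => graphNormal e (fun z => φ z) ((ℝ ∙ e)ᗮ.orthogonalProjectionOnto y),
    (measurable_graphNormal _).comp (by fun_prop : Continuous fun y =>
      (ℝ ∙ e)ᗮ.orthogonalProjectionOnto y).measurable, ?_⟩
  filter_upwards [ae_restrict_of_ae (h.ae_exists_eq_graphMap hd hΩ),
    ae_restrict_mem (isClosed_frontier.measurableSet.inter h.isOpen.measurableSet)] with y hy hym
  obtain ⟨x, hx, rfl⟩ := hy hym.2 hym.1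
  rw [outerNormal_eq (h.isOuterUnitNormal hx hym.2)]
  simp only [graphMap, orthogonalProjectionOnto_vert]

theorem IsGraphPatch.measure_lt_top (hd : 2 ≤ d) (h : IsGraphPatch Ω e φ K U)
    (hΩ : IsOpen Ω) (x : Vec d) :
    μHE[d - 1] (U ∩ Metric.ball x 1 ∩ frontier Ω) < ⊤ := by
  have hψ := h.lipschitz_restrict
  have hb : Bornology.IsBounded (graphMap e (fun z : (ℝ ∙ e)ᗮ => φ z) ⁻¹' Metric.ball x 1) :=
    (antilipschitzWith_graphMap h.norm_eq _).isBounded_preimage Metric.isBounded_ball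
  have hlt := (graphMeasure_le h.norm_eq hψ _).trans_lt
    (ENNReal.mul_lt_top (by simp) hb.measure_lt_top)
  rw [graphMeasure_apply h.norm_eq hψ,
    finrank_orthogonal_singleton (by omega) h.norm_eq] at hlt
  refine (measure_mono ?_).trans_lt hlt
  rintro y ⟨⟨hyU, hyb⟩, hyf⟩
  obtain ⟨z, rfl⟩ := (h.mem_frontier_iff hΩ hyU).1 hyf
  exact mem_image_of_mem _ hyb

end Patch

section Lipschitz

variable {d : ℕ} {Ω : Set (Vec d)}

theorem IsLipschitzDomain.exists_patch (hΩ : IsLipschitzDomain Ω) {x : Vec d}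
    (hx : x ∈ frontier Ω) : ∃ e φ K U, x ∈ U ∧ IsGraphPatch Ω e φ K U := by
  obtain ⟨e, φ, K, U, he, hφ, hU, hxU, h⟩ := hΩ.locally_graph x hx
  exact ⟨e, φ, K, U, hxU, he, hφ, hU, h⟩

theorem IsLipschitzDomain.isCompact_closure (hΩ : IsLipschitzDomain Ω) : IsCompact (closure Ω) :=
  hΩ.isBounded.isCompact_closure

theorem IsLipschitzDomain.isCompact_frontier (hΩ : IsLipschitzDomain Ω) :
    IsCompact (frontier Ω) :=
  hΩ.isCompact_closure.of_isClosed_subset isClosed_frontier frontier_subset_closure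

theorem IsLipschitzDomain.isFiniteMeasure_surfaceMeasure (hd : 2 ≤ d)
    (hΩ : IsLipschitzDomain Ω) : IsFiniteMeasure (surfaceMeasure Ω) := by
  refine ⟨?_⟩
  rw [surfaceMeasure, Measure.restrict_apply_univ]
  refine hΩ.isCompact_frontier.measure_lt_top_of_nhdsWithin fun x hx => ?_
  obtain ⟨e, φ, K, U, hxU, h⟩ := hΩ.exists_patch hx
  refine ⟨U ∩ Metric.ball x 1 ∩ frontier Ω, ?_, h.measure_lt_top hd hΩ.isOpen x⟩
  exact inter_mem (mem_nhdsWithin_of_mem_nhds (inter_mem (h.isOpen.mem_nhds hxU)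
    (Metric.ball_mem_nhds x one_pos))) self_mem_nhdsWithin

theorem IsLipschitzDomain.isFiniteMeasure_volume (hΩ : IsLipschitzDomain Ω) :
    IsFiniteMeasure (volume.restrict Ω) :=
  ⟨by rw [Measure.restrict_apply_univ]; exact hΩ.isBounded.measure_lt_top⟩

/-- A Lipschitz domain has an outer unit normal at almost all of its boundary points. -/
theorem IsLipschitzDomain.ae_isOuterUnitNormal (hd : 2 ≤ d) (hΩ : IsLipschitzDomain Ω) :
    ∀ᵐ x ∂(surfaceMeasure Ω), x ∈ frontier Ω ∧ IsOuterUnitNormal Ω x (outerNormal Ω x) := by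
  rw [surfaceMeasure]
  have hnull : μHE[d - 1] {y ∈ frontier Ω | ¬ ∃ n, IsOuterUnitNormal Ω y n} = 0 := by
    apply measure_null_of_locally_null
    intro x hx
    obtain ⟨e, φ, K, U, hxU, h⟩ := hΩ.exists_patch hx.1
    refine ⟨_, inter_mem (mem_nhdsWithin_of_mem_nhds (h.isOpen.mem_nhds hxU))
      self_mem_nhdsWithin, ?_⟩
    rw [measure_eq_zero_iff_ae_notMem]
    filter_upwards [h.ae_exists_eq_graphMap hd hΩ.isOpen] with y hy hym
    obtain ⟨x, hx, rfl⟩ := hy hym.1 hym.2.1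
    exact hym.2.2 ⟨_, h.isOuterUnitNormal hx hym.1⟩
  have h1 := measure_eq_zero_iff_ae_notMem.1 hnull
  filter_upwards [ae_restrict_of_ae h1, ae_restrict_mem isClosed_frontier.measurableSet]
    with x hx hxf
  refine ⟨hxf, outerNormal_spec ?_⟩
  by_contra hno
  exact hx ⟨hxf, hno⟩

theorem IsLipschitzDomain.aemeasurable_outerNormal (hd : 2 ≤ d) (hΩ : IsLipschitzDomain Ω) :
    AEMeasurable (outerNormal Ω) (surfaceMeasure Ω) := by
  choose! e φ K U hxU h using fun x (hx : x ∈ frontier Ω) => hΩ.exists_patch hx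
  obtain ⟨t, ht, hcov⟩ := hΩ.isCompact_frontier.elim_nhds_subcover U
    fun x hx => (h x hx).isOpen.mem_nhds (hxU x hx)
  have hun : ⋃ x : t, (frontier Ω ∩ U x) = frontier Ω := by
    rw [← inter_iUnion]
    apply inter_eq_left.2
    intro y hy
    obtain ⟨x, hx, hyx⟩ := mem_iUnion₂.1 (hcov hy)
    exact mem_iUnion.2 ⟨⟨x, hx⟩, hyx⟩
  rw [surfaceMeasure, ← hun, aemeasurable_iUnion_iff]
  exact fun x => (h x (ht x x.2)).aemeasurable_outerNormal hd hΩ.isOpen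

/-- The divergence theorem for functions supported inside `Ω`. -/
theorem setIntegral_fderiv_of_tsupport_subset {g : Vec d → ℝ} (hg : ContDiff ℝ 1 g)
    (hc : HasCompactSupport g) (hgU : tsupport g ⊆ Ω) (hΩ : IsOpen Ω) (v : Vec d) :
    ∫ y in Ω, fderiv ℝ g y v = ∫ y, g y * inner ℝ v (outerNormal Ω y) ∂(surfaceMeasure Ω) := by
  obtain ⟨C, hC⟩ := ContDiff.lipschitzWith_of_hasCompactSupport hc hg one_ne_zero
  have h0 := integral_lineDeriv_eq_zero volume hC hc v
  have h1 : ∫ y in Ω, fderiv ℝ g y v = 0 := by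
    rw [setIntegral_eq_integral_of_forall_compl_eq_zero, ← h0]
    · congr 1; ext y
      rw [((hg.differentiable one_ne_zero) y).lineDeriv_eq_fderiv]
    · intro y hy
      have : fderiv ℝ g y = 0 := by
        by_contra hne
        exact hy (hgU (support_fderiv_subset ℝ hne))
      simp [this]
  rw [h1, eq_comm, surfaceMeasure]
  apply setIntegral_eq_zero_of_forall_eq_zero
  intro y hy
  rw [hΩ.frontier_eq] at hy
  rw [image_eq_zero_of_notMem_tsupport fun h => hy.2 (hgU h), zero_mul]

end Lipschitz

section Divergence

variable {d : ℕ} {Ω : Set (Vec d)}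

theorem ae_surfaceMeasure_mem (Ω : Set (Vec d)) :
    ∀ᵐ x ∂(surfaceMeasure Ω), x ∈ frontier Ω :=
  ae_restrict_mem isClosed_frontier.measurableSet

/-- A quantity that depends continuously on the boundary point and on the normal is integrable over
the boundary. -/
theorem IsLipschitzDomain.integrable_comp_outerNormal (hd : 2 ≤ d) (hΩ : IsLipschitzDomain Ω)
    {F : Vec d × Vec d → ℝ} (hF : ContinuousOn F (frontier Ω ×ˢ Metric.closedBall 0 1)) :
    Integrable (fun x => F (x, outerNormal Ω x)) (surfaceMeasure Ω) := by
  have := hΩ.isFiniteMeasure_surfaceMeasure hd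
  have hcomp : IsCompact (frontier Ω ×ˢ Metric.closedBall (0 : Vec d) 1) :=
    hΩ.isCompact_frontier.prod (isCompact_closedBall _ _)
  obtain ⟨C, hC⟩ := hcomp.exists_bound_of_continuousOn hF
  have hmem : ∀ᵐ x ∂(surfaceMeasure Ω),
      (x, outerNormal Ω x) ∈ frontier Ω ×ˢ Metric.closedBall (0 : Vec d) 1 := by
    filter_upwards [ae_surfaceMeasure_mem Ω] with x hx
    exact ⟨hx, by simpa using norm_outerNormal_le Ω x⟩
  have hmeas : Measurable
      ((frontier Ω ×ˢ Metric.closedBall (0 : Vec d) 1).indicator F) := by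
    classical
    rw [← piecewise_eq_indicator]
    exact hF.measurable_piecewise continuousOn_const hcomp.measurableSet
  have hae : AEStronglyMeasurable (fun x => F (x, outerNormal Ω x)) (surfaceMeasure Ω) := by
    have h1 := hmeas.comp_aemeasurable
      (aemeasurable_id.prodMk (hΩ.aemeasurable_outerNormal hd))
    refine h1.aestronglyMeasurable.congr ?_
    filter_upwards [hmem] with x hx
    exact indicator_of_mem hx F
  refine Integrable.of_bound hae C ?_
  filter_upwards [hmem] with x hx using hC _ hx

theorem IsLipschitzDomain.integrable_surfaceMeasure (hd : 2 ≤ d) (hΩ : IsLipschitzDomain Ω)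
    {f : Vec d → ℝ} (hf : ContinuousOn f (frontier Ω)) : Integrable f (surfaceMeasure Ω) :=
  hΩ.integrable_comp_outerNormal hd (F := fun q => f q.1)
    (hf.comp continuousOn_fst fun _ hq => hq.1)

theorem IsLipschitzDomain.integrableOn (hΩ : IsLipschitzDomain Ω)
    {f : Vec d → ℝ} (hf : ContinuousOn f (closure Ω)) : IntegrableOn f Ω :=
  (hf.integrableOn_compact hΩ.isCompact_closure).mono_set subset_closure

/-- **Divergence theorem** on Lipschitz domains, for directional derivatives. -/
theorem IsLipschitzDomain.setIntegral_fderiv (hd : 2 ≤ d) (hΩ : IsLipschitzDomain Ω)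
    {g : Vec d → ℝ} (hg : ∀ x ∈ closure Ω, ContDiffAt ℝ 1 g x) (v : Vec d) :
    ∫ y in Ω, fderiv ℝ g y v = ∫ y, g y * inner ℝ v (outerNormal Ω y) ∂(surfaceMeasure Ω) := by
  -- every point of the closure has a neighbourhood in which the theorem is known
  have hloc : ∀ x ∈ closure Ω, ∃ V : Set (Vec d), IsOpen V ∧ x ∈ V ∧
      ∀ h : Vec d → ℝ, ContDiff ℝ 1 h → HasCompactSupport h → tsupport h ⊆ V →
        ∫ y in Ω, fderiv ℝ h y v =
          ∫ y, h y * inner ℝ v (outerNormal Ω y) ∂(surfaceMeasure Ω) := by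
    intro x hx
    by_cases hxΩ : x ∈ Ω
    · exact ⟨Ω, hΩ.isOpen, hxΩ, fun h h1 h2 h3 =>
        setIntegral_fderiv_of_tsupport_subset h1 h2 h3 hΩ.isOpen v⟩
    · have hxf : x ∈ frontier Ω := by
        rw [hΩ.isOpen.frontier_eq]; exact ⟨hx, hxΩ⟩
      obtain ⟨e, φ, K, U, hxU, hp⟩ := hΩ.exists_patch hxf
      exact ⟨U, hp.isOpen, hxU, fun h h1 h2 h3 =>
        hp.setIntegral_fderiv hd hΩ.isOpen h1 h2 h3 v⟩
  choose! V hVo hxV hV using hloc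
  have hW : ∀ x ∈ closure Ω, ∃ W : Set (Vec d), IsOpen W ∧ x ∈ W ∧
      ∀ y ∈ W, ContDiffAt ℝ 1 g y := by
    intro x hx
    obtain ⟨W, hW, hWo, hxW⟩ := eventually_nhds_iff.1 ((hg x hx).eventually (by simp))
    exact ⟨W, hWo, hxW, hW⟩
  choose! W hWo hxW hW using hW
  set Q : Vec d → Set (Vec d) := fun x => V x ∩ W x ∩ Metric.ball x 1 with hQ
  have hQo : ∀ x ∈ closure Ω, IsOpen (Q x) := fun x hx =>
    ((hVo x hx).inter (hWo x hx)).inter Metric.isOpen_ball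
  obtain ⟨t, ht, hcov⟩ := hΩ.isCompact_closure.elim_nhds_subcover Q fun x hx =>
    (hQo x hx).mem_nhds ⟨⟨hxV x hx, hxW x hx⟩, Metric.mem_ball_self one_pos⟩
  obtain ⟨ρ, hρ⟩ := SmoothPartitionOfUnity.exists_isSubordinate (modelWithCornersSelf ℝ (Vec d))
    (isClosed_closure (s := Ω)) (fun x : t => Q x) (fun x => hQo x (ht x x.2))
    (by
      intro y hy
      obtain ⟨x, hx, hyx⟩ := mem_iUnion₂.1 (hcov hy)
      exact mem_iUnion.2 ⟨⟨x, hx⟩, hyx⟩)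
  have hsum : ∀ y ∈ closure Ω, ∑ i, ρ i y = 1 := by
    intro y hy
    rw [← finsum_eq_sum_of_fintype]
    exact ρ.sum_eq_one hy
  set h : t → Vec d → ℝ := fun i y => ρ i y * g y with hh
  have hts : ∀ i, tsupport (h i) ⊆ Q i := fun i =>
    (tsupport_mul_subset_left (f := ρ i) (g := g)).trans (hρ i)
  have hcd : ∀ i, ContDiff ℝ 1 (h i) := by
    intro i
    rw [contDiff_iff_contDiffAt]
    intro y
    by_cases hy : y ∈ tsupport (h i)
    swap
    · exact contDiffAt_const.congr_of_eventuallyEq (notMem_tsupport_iff_eventuallyEq.1 hy)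
    have h1 : ContDiff ℝ ∞ (ρ i) := (ρ i).contMDiff.contDiff
    exact ((h1.of_le (by simp)).contDiffAt).mul (hW i (ht i i.2) y (hts i hy).1.2)
  have hcs : ∀ i, HasCompactSupport (h i) := fun i =>
    HasCompactSupport.of_support_subset_isCompact (isCompact_closedBall (i : Vec d) 1)
      ((subset_tsupport _).trans ((hts i).trans
        (inter_subset_right.trans Metric.ball_subset_closedBall)))
  have hpart : ∀ i, ∫ y in Ω, fderiv ℝ (h i) y v =
      ∫ y, h i y * inner ℝ v (outerNormal Ω y) ∂(surfaceMeasure Ω) := fun i =>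
    hV i (ht i i.2) (h i) (hcd i) (hcs i)
      ((hts i).trans (inter_subset_left.trans inter_subset_left))
  have hgsum : ∀ y ∈ closure Ω, g y = ∑ i, h i y := by
    intro y hy
    rw [← Finset.sum_mul, hsum y hy, one_mul]
  have hL : ∫ y in Ω, fderiv ℝ g y v = ∑ i, ∫ y in Ω, fderiv ℝ (h i) y v := by
    rw [← integral_finsetSum]
    · apply setIntegral_congr_fun hΩ.isOpen.measurableSet
      intro y hy
      have heq : g =ᶠ[𝓝 y] fun z => ∑ i, h i z := by
        filter_upwards [hΩ.isOpen.mem_nhds hy] with z hz using hgsum z (subset_closure hz)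
      simp only
      rw [heq.fderiv_eq, fderiv_fun_sum fun i _ => ((hcd i).differentiable one_ne_zero) y]
      simp
    · intro i _
      exact (((hcd i).continuous_fderiv one_ne_zero).clm_apply
        continuous_const).integrable_of_hasCompactSupport ((hcs i).fderiv_apply ℝ v)
  have hR : ∫ y, g y * inner ℝ v (outerNormal Ω y) ∂(surfaceMeasure Ω) =
      ∑ i, ∫ y, h i y * inner ℝ v (outerNormal Ω y) ∂(surfaceMeasure Ω) := by
    rw [← integral_finsetSum]
    · apply integral_congr_ae
      filter_upwards [ae_surfaceMeasure_mem Ω] with y hy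
      rw [hgsum y (frontier_subset_closure hy), Finset.sum_mul]
    · intro i _
      have hci := (hcd i).continuous
      exact hΩ.integrable_comp_outerNormal hd (F := fun q => h i q.1 * inner ℝ v q.2)
        (Continuous.continuousOn (by fun_prop))
  rw [hL, hR]
  exact Finset.sum_congr rfl fun i _ => hpart i

theorem contDiffAt_coord {w : Vec d → Vec d} {x : Vec d} {n : WithTop ℕ∞}
    (hw : ContDiffAt ℝ n w x) (i : Fin d) : ContDiffAt ℝ n (fun y => w y i) x :=
  contDiffAt_piLp (p := 2) |>.1 hw i

theorem continuousOn_pd {K : Set (Vec d)} {g : Vec d → ℝ}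
    (hg : ∀ x ∈ K, ContDiffAt ℝ 1 g x) (i : Fin d) : ContinuousOn (pd i g) K := by
  intro x hx
  have := ((hg x hx).fderiv_right (m := 0) (by simp)).continuousAt
  exact (this.clm_apply continuousAt_const).continuousWithinAt

theorem continuousOn_divg {K : Set (Vec d)} {w : Vec d → Vec d}
    (hw : ∀ x ∈ K, ContDiffAt ℝ 1 w x) : ContinuousOn (divg w) K :=
  continuousOn_finsetSum _ fun i _ => continuousOn_pd (fun x hx => contDiffAt_coord (hw x hx) i) i

/-- **Divergence theorem** on Lipschitz domains. -/
theorem IsLipschitzDomain.setIntegral_divg (hd : 2 ≤ d) (hΩ : IsLipschitzDomain Ω)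
    {w : Vec d → Vec d} (hw : ∀ x ∈ closure Ω, ContDiffAt ℝ 1 w x) :
    ∫ y in Ω, divg w y = ∫ y, inner ℝ (w y) (outerNormal Ω y) ∂(surfaceMeasure Ω) := by
  have hc : ∀ i, ContinuousOn (fun y => w y i) (frontier Ω) := fun i x hx =>
    (contDiffAt_coord (hw x (frontier_subset_closure hx)) i).continuousAt.continuousWithinAt
  have hin : ∀ y, inner ℝ (w y) (outerNormal Ω y) =
      ∑ i, w y i * inner ℝ (EuclideanSpace.single i (1 : ℝ)) (outerNormal Ω y) := by
    intro y
    simp [PiLp.inner_apply, mul_comm]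
  simp only [hin, divg]
  rw [integral_finsetSum, integral_finsetSum]
  · refine Finset.sum_congr rfl fun i _ => ?_
    exact hΩ.setIntegral_fderiv hd (fun x hx => contDiffAt_coord (hw x hx) i) _
  · intro i _
    refine hΩ.integrable_comp_outerNormal hd
      (F := fun q => w q.1 i * inner ℝ (EuclideanSpace.single i (1 : ℝ)) q.2) ?_
    exact ((hc i).comp continuousOn_fst fun _ hq => hq.1).mul
      (Continuous.continuousOn (by fun_prop))
  · intro i _
    exact hΩ.integrableOn (continuousOn_pd (fun x hx => contDiffAt_coord (hw x hx) i) i)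

end Divergence

/-! ### Calculus of space-time fields -/

section Partial

variable {d : ℕ} {x : Vec d}

theorem pd_mul {a b : Vec d → ℝ} (ha : DifferentiableAt ℝ a x) (hb : DifferentiableAt ℝ b x)
    (i : Fin d) : pd i (fun y => a y * b y) x = a x * pd i b x + pd i a x * b x := by
  simp only [pd]
  rw [fderiv_fun_mul ha hb]
  simp; ring

theorem pd_add {a b : Vec d → ℝ} (ha : DifferentiableAt ℝ a x) (hb : DifferentiableAt ℝ b x)
    (i : Fin d) : pd i (fun y => a y + b y) x = pd i a x + pd i b x := by
  simp only [pd]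
  rw [fderiv_fun_add ha hb]
  rfl

theorem pd_sub {a b : Vec d → ℝ} (ha : DifferentiableAt ℝ a x) (hb : DifferentiableAt ℝ b x)
    (i : Fin d) : pd i (fun y => a y - b y) x = pd i a x - pd i b x := by
  simp only [pd]
  rw [fderiv_fun_sub ha hb]
  rfl

theorem pd_sum {ι : Type*} {s : Finset ι} {a : ι → Vec d → ℝ}
    (ha : ∀ k ∈ s, DifferentiableAt ℝ (a k) x) (i : Fin d) :
    pd i (fun y => ∑ k ∈ s, a k y) x = ∑ k ∈ s, pd i (a k) x := by
  simp only [pd]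
  rw [fderiv_fun_sum ha, _root_.sum_apply]

end Partial

section Smooth

variable {d : ℕ} {F F' : Type*} [NormedAddCommGroup F] [NormedSpace ℝ F]
  [NormedAddCommGroup F'] [NormedSpace ℝ F']

/-- The space-time field `f` is smooth at `(t, x)`, jointly in both variables. -/
def SmoothAt (f : ℝ → Vec d → F) (t : ℝ) (x : Vec d) : Prop :=
  ContDiffAt ℝ ∞ (fun q : ℝ × Vec d => f q.1 q.2) (t, x)

variable {f g : ℝ → Vec d → F} {t : ℝ} {x : Vec d}

theorem SmoothAt.differentiableAt (hf : SmoothAt f t x) :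
    DifferentiableAt ℝ (fun q : ℝ × Vec d => f q.1 q.2) (t, x) :=
  ContDiffAt.differentiableAt hf (by simp)

theorem SmoothAt.add (hf : SmoothAt f t x) (hg : SmoothAt g t x) :
    SmoothAt (fun s y => f s y + g s y) t x :=
  ContDiffAt.add hf hg

theorem SmoothAt.sub (hf : SmoothAt f t x) (hg : SmoothAt g t x) :
    SmoothAt (fun s y => f s y - g s y) t x :=
  ContDiffAt.sub hf hg

theorem SmoothAt.const (k : F) : SmoothAt (d := d) (fun _ _ => k) t x :=
  contDiffAt_const

theorem SmoothAt.smul {a : ℝ → Vec d → ℝ} (ha : SmoothAt a t x) (hf : SmoothAt f t x) :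
    SmoothAt (fun s y => a s y • f s y) t x :=
  ContDiffAt.smul ha hf

theorem SmoothAt.mul {a b : ℝ → Vec d → ℝ} (ha : SmoothAt a t x) (hb : SmoothAt b t x) :
    SmoothAt (fun s y => a s y * b s y) t x :=
  ContDiffAt.mul ha hb

theorem SmoothAt.div_const {a : ℝ → Vec d → ℝ} (ha : SmoothAt a t x) (k : ℝ) :
    SmoothAt (fun s y => a s y / k) t x :=
  ContDiffAt.div_const ha k

theorem SmoothAt.const_mul {a : ℝ → Vec d → ℝ} (ha : SmoothAt a t x) (k : ℝ) :
    SmoothAt (fun s y => k * a s y) t x :=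
  (SmoothAt.const k).mul ha

theorem SmoothAt.pow {a : ℝ → Vec d → ℝ} (ha : SmoothAt a t x) (n : ℕ) :
    SmoothAt (fun s y => a s y ^ n) t x :=
  ContDiffAt.pow ha n

theorem SmoothAt.sum {ι : Type*} {s : Finset ι} {h : ι → ℝ → Vec d → F}
    (hh : ∀ i ∈ s, SmoothAt (h i) t x) : SmoothAt (fun r y => ∑ i ∈ s, h i r y) t x :=
  ContDiffAt.sum hh

theorem SmoothAt.comp {k : ℝ → ℝ} {a : ℝ → Vec d → ℝ} (hk : ContDiffAt ℝ ∞ k (a t x))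
    (ha : SmoothAt a t x) : SmoothAt (fun s y => k (a s y)) t x :=
  ContDiffAt.comp (t, x) hk ha

theorem SmoothAt.coord {w : ℝ → Vec d → Vec d} (hw : SmoothAt w t x) (i : Fin d) :
    SmoothAt (fun s y => w s y i) t x :=
  contDiffAt_piLp (p := 2) |>.1 hw i

theorem SmoothAt.norm_sq {w : ℝ → Vec d → Vec d} (hw : SmoothAt w t x) :
    SmoothAt (fun s y => ‖w s y‖ ^ 2) t x :=
  ContDiffAt.norm_sq ℝ hw

theorem SmoothAt.toLp {h : Fin d → ℝ → Vec d → ℝ} (hh : ∀ i, SmoothAt (h i) t x) :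
    SmoothAt (fun s y => (WithLp.toLp 2 fun i => h i s y : Vec d)) t x :=
  contDiffAt_piLp (p := 2) |>.2 fun i => hh i

theorem SmoothAt.slice (hf : SmoothAt f t x) : ContDiffAt ℝ ∞ (f t) x := by
  have h1 : ContDiffAt ℝ ∞ (fun y : Vec d => (t, y)) x := by fun_prop
  exact ContDiffAt.comp x (f := fun y : Vec d => (t, y)) hf h1

theorem SmoothAt.slice_one (hf : SmoothAt f t x) : ContDiffAt ℝ 1 (f t) x :=
  hf.slice.of_le (by simp)

theorem SmoothAt.slice_differentiableAt (hf : SmoothAt f t x) : DifferentiableAt ℝ (f t) x :=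
  hf.slice.differentiableAt (by simp)

theorem hasFDerivAt_slice
    (hf : DifferentiableAt ℝ (fun q : ℝ × Vec d => f q.1 q.2) (t, x)) :
    HasFDerivAt (f t) ((fderiv ℝ (fun q : ℝ × Vec d => f q.1 q.2) (t, x)).comp
      (ContinuousLinearMap.inr ℝ ℝ (Vec d))) x :=
  HasFDerivAt.comp (f := fun y : Vec d => (t, y)) x hf.hasFDerivAt (hasFDerivAt_prodMk_right t x)

theorem hasDerivAt_time
    (hf : DifferentiableAt ℝ (fun q : ℝ × Vec d => f q.1 q.2) (t, x)) :
    HasDerivAt (fun s => f s x) (fderiv ℝ (fun q : ℝ × Vec d => f q.1 q.2) (t, x) (1, 0)) t := by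
  have := (HasFDerivAt.comp (f := fun s : ℝ => (s, x)) t hf.hasFDerivAt
    (hasFDerivAt_prodMk_left t x)).hasDerivAt
  simpa [Function.comp_def] using this

theorem SmoothAt.eventually_differentiableAt (hf : SmoothAt f t x) :
    ∀ᶠ q : ℝ × Vec d in 𝓝 (t, x),
      DifferentiableAt ℝ (fun q : ℝ × Vec d => f q.1 q.2) (q.1, q.2) := by
  have h1 : ContDiffAt ℝ 1 (fun q : ℝ × Vec d => f q.1 q.2) (t, x) := ContDiffAt.of_le hf (by simp)
  filter_upwards [h1.eventually (by simp)] with q hq using hq.differentiableAt one_ne_zero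

theorem SmoothAt.joint_fderiv (hf : SmoothAt f t x) :
    ContDiffAt ℝ ∞ (fderiv ℝ fun q : ℝ × Vec d => f q.1 q.2) (t, x) :=
  ContDiffAt.fderiv_right hf (by simp)

theorem SmoothAt.eventually_fderiv_eq (hf : SmoothAt f t x) (v : Vec d) :
    (fun q : ℝ × Vec d => fderiv ℝ (f q.1) q.2 v) =ᶠ[𝓝 (t, x)]
      fun q => fderiv ℝ (fun q : ℝ × Vec d => f q.1 q.2) q (0, v) := by
  filter_upwards [hf.eventually_differentiableAt] with q hq
  rw [(hasFDerivAt_slice hq).fderiv]; simp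

theorem SmoothAt.eventually_deriv_eq (hf : SmoothAt f t x) :
    (fun q : ℝ × Vec d => deriv (fun s => f s q.2) q.1) =ᶠ[𝓝 (t, x)]
      fun q => fderiv ℝ (fun q : ℝ × Vec d => f q.1 q.2) q (1, 0) := by
  filter_upwards [hf.eventually_differentiableAt] with q hq
  exact (hasDerivAt_time hq).deriv

theorem SmoothAt.fderiv_space (hf : SmoothAt f t x) (v : Vec d) :
    SmoothAt (fun s y => fderiv ℝ (f s) y v) t x :=
  ContDiffAt.congr_of_eventuallyEq (hf.joint_fderiv.clm_apply contDiffAt_const)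
    (hf.eventually_fderiv_eq v)

theorem SmoothAt.deriv_time (hf : SmoothAt f t x) :
    SmoothAt (fun s y => deriv (fun r => f r y) s) t x :=
  ContDiffAt.congr_of_eventuallyEq (hf.joint_fderiv.clm_apply contDiffAt_const)
    hf.eventually_deriv_eq

theorem SmoothAt.pd {a : ℝ → Vec d → ℝ} (ha : SmoothAt a t x) (i : Fin d) :
    SmoothAt (fun s y => QNSCH.pd i (a s) y) t x :=
  ha.fderiv_space _

theorem SmoothAt.divg {w : ℝ → Vec d → Vec d} (hw : SmoothAt w t x) :
    SmoothAt (fun s y => QNSCH.divg (w s) y) t x :=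
  SmoothAt.sum fun i _ => (hw.coord i).pd i

theorem gradient_apply (h : Vec d → ℝ) (y : Vec d) (i : Fin d) : gradient h y i = pd i h y := by
  have := InnerProductSpace.toDual_symm_apply (𝕜 := ℝ) (x := EuclideanSpace.single i (1 : ℝ))
    (y := fderiv ℝ h y)
  rw [pd, ← this, gradient, real_inner_comm]
  simp [EuclideanSpace.inner_single_left]

theorem gradient_eq_toLp (h : Vec d → ℝ) (y : Vec d) :
    gradient h y = WithLp.toLp 2 fun i => pd i h y := by
  ext i; exact gradient_apply h y i

theorem SmoothAt.gradient {a : ℝ → Vec d → ℝ} (ha : SmoothAt a t x) :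
    SmoothAt (fun s y => _root_.gradient (a s) y) t x := by
  simp only [gradient_eq_toLp]
  exact SmoothAt.toLp fun i => ha.pd i

theorem SmoothAt.strain {w : ℝ → Vec d → Vec d} (hw : SmoothAt w t x) (i j : Fin d) :
    SmoothAt (fun s y => QNSCH.strain (w s) y i j) t x :=
  (((hw.coord j).pd i).add ((hw.coord i).pd j)).div_const 2

/-- Mixed second derivatives of a space-time field commute. -/
theorem SmoothAt.fderiv_fderiv_comm (hf : SmoothAt f t x) (v w : ℝ × Vec d) :
    fderiv ℝ (fun q => fderiv ℝ (fun q : ℝ × Vec d => f q.1 q.2) q v) (t, x) w =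
      fderiv ℝ (fun q => fderiv ℝ (fun q : ℝ × Vec d => f q.1 q.2) q w) (t, x) v := by
  have hd := hf.joint_fderiv.differentiableAt (by simp)
  have hs : IsSymmSndFDerivAt ℝ (fun q : ℝ × Vec d => f q.1 q.2) (t, x) :=
    ContDiffAt.isSymmSndFDerivAt hf (by
      simp only [minSmoothness_of_isRCLikeNormedField]
      exact ENat.LEInfty.out)
  rw [fderiv_clm_apply hd (differentiableAt_const _), fderiv_clm_apply hd
    (differentiableAt_const _)]
  simpa using hs.eq w v

theorem SmoothAt.fderiv_deriv_comm (hf : SmoothAt f t x) (v : Vec d) :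
    fderiv ℝ (fun y => deriv (fun s => f s y) t) x v = deriv (fun s => fderiv ℝ (f s) x v) t := by
  have h1 := (hasFDerivAt_slice (f := fun s y => deriv (fun r => f r y) s)
    hf.deriv_time.differentiableAt).fderiv
  have h2 := (hasDerivAt_time (f := fun s y => fderiv ℝ (f s) y v)
    (hf.fderiv_space v).differentiableAt).deriv
  rw [h1, h2, hf.eventually_deriv_eq.fderiv_eq, (hf.eventually_fderiv_eq v).fderiv_eq]
  simpa using hf.fderiv_fderiv_comm (1, 0) (0, v)

theorem SmoothAt.fderiv_space_comm (hf : SmoothAt f t x) (v w : Vec d) :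
    fderiv ℝ (fun y => fderiv ℝ (f t) y v) x w = fderiv ℝ (fun y => fderiv ℝ (f t) y w) x v := by
  have h1 := (hasFDerivAt_slice (f := fun s y => fderiv ℝ (f s) y v)
    (hf.fderiv_space v).differentiableAt).fderiv
  have h2 := (hasFDerivAt_slice (f := fun s y => fderiv ℝ (f s) y w)
    (hf.fderiv_space w).differentiableAt).fderiv
  rw [h1, h2, (hf.eventually_fderiv_eq v).fderiv_eq, (hf.eventually_fderiv_eq w).fderiv_eq]
  simpa using hf.fderiv_fderiv_comm (0, v) (0, w)

/-- The material derivative is the space-time derivative in the direction `(1, u)`. -/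
theorem SmoothAt.matDeriv_eq (hf : SmoothAt f t x) (u : ℝ → Vec d → Vec d) :
    matDeriv u f t x = fderiv ℝ (fun q : ℝ × Vec d => f q.1 q.2) (t, x) (1, u t x) := by
  rw [matDeriv, (hasDerivAt_time hf.differentiableAt).deriv,
    (hasFDerivAt_slice hf.differentiableAt).fderiv, ContinuousLinearMap.comp_apply,
    ContinuousLinearMap.inr_apply, ← map_add]
  simp

theorem SmoothAt.deriv_hasDerivAt (hf : SmoothAt f t x) :
    HasDerivAt (fun s => f s x) (deriv (fun s => f s x) t) t :=
  (hasDerivAt_time hf.differentiableAt).differentiableAt.hasDerivAt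

theorem fderiv_eq_sum_pd (h : Vec d → ℝ) (y w : Vec d) :
    fderiv ℝ h y w = ∑ j, w j * pd j h y := by
  conv_lhs => rw [← (EuclideanSpace.basisFun (Fin d) ℝ).sum_repr w]
  simp [pd]

theorem SmoothAt.matDeriv {u : ℝ → Vec d → Vec d} (hu : SmoothAt u t x) {a : ℝ → Vec d → ℝ}
    (ha : SmoothAt a t x) : SmoothAt (fun s y => QNSCH.matDeriv u a s y) t x := by
  simp only [QNSCH.matDeriv, fderiv_eq_sum_pd]
  exact ha.deriv_time.add (SmoothAt.sum fun j _ => (hu.coord j).mul (ha.pd j))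

section MatDeriv

variable {u : ℝ → Vec d → Vec d} {a b : ℝ → Vec d → ℝ}

theorem matDeriv_add (ha : SmoothAt a t x) (hb : SmoothAt b t x) :
    matDeriv u (fun s y => a s y + b s y) t x = matDeriv u a t x + matDeriv u b t x := by
  rw [(ha.add hb).matDeriv_eq, ha.matDeriv_eq, hb.matDeriv_eq,
    fderiv_fun_add ha.differentiableAt hb.differentiableAt]
  rfl

theorem matDeriv_mul (ha : SmoothAt a t x) (hb : SmoothAt b t x) :
    matDeriv u (fun s y => a s y * b s y) t x =
      matDeriv u a t x * b t x + a t x * matDeriv u b t x := by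
  rw [(ha.mul hb).matDeriv_eq, ha.matDeriv_eq, hb.matDeriv_eq,
    fderiv_fun_mul ha.differentiableAt hb.differentiableAt]
  simp; ring

theorem matDeriv_const_mul (k : ℝ) (ha : SmoothAt a t x) :
    matDeriv u (fun s y => k * a s y) t x = k * matDeriv u a t x := by
  rw [(ha.const_mul k).matDeriv_eq, ha.matDeriv_eq,
    fderiv_const_mul ha.differentiableAt]
  simp

theorem matDeriv_sum {ι : Type*} {s : Finset ι} {h : ι → ℝ → Vec d → ℝ}
    (hh : ∀ i ∈ s, SmoothAt (h i) t x) :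
    matDeriv u (fun r y => ∑ i ∈ s, h i r y) t x = ∑ i ∈ s, matDeriv u (h i) t x := by
  rw [(SmoothAt.sum hh).matDeriv_eq, fderiv_fun_sum fun i hi => (hh i hi).differentiableAt]
  simp only [_root_.sum_apply]
  exact Finset.sum_congr rfl fun i hi => ((hh i hi).matDeriv_eq u).symm

theorem matDeriv_comp {k : ℝ → ℝ} (hk : ContDiffAt ℝ ∞ k (a t x)) (ha : SmoothAt a t x) :
    matDeriv u (fun s y => k (a s y)) t x = deriv k (a t x) * matDeriv u a t x := by
  rw [(SmoothAt.comp hk ha).matDeriv_eq, ha.matDeriv_eq]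
  have h1 := (hk.differentiableAt (by simp)).hasDerivAt
  have h2 := (HasDerivAt.comp_hasFDerivAt (t, x) h1 ha.differentiableAt.hasFDerivAt).fderiv
  rw [Function.comp_def] at h2
  rw [h2]; simp

theorem matDeriv_apply {w : ℝ → Vec d → Vec d} (hw : SmoothAt w t x)
    (i : Fin d) : matDeriv u w t x i = matDeriv u (fun s y => w s y i) t x := by
  rw [hw.matDeriv_eq, (hw.coord i).matDeriv_eq]
  have h1 := (EuclideanSpace.proj (𝕜 := ℝ) i : Vec d →L[ℝ] ℝ).hasFDerivAt.comp (t, x)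
    hw.differentiableAt.hasFDerivAt
  exact (DFunLike.congr_fun h1.fderiv (1, u t x)).symm

end MatDeriv

/-- The commutator of the material derivative with a partial derivative. -/
theorem matDeriv_pd {u : ℝ → Vec d → Vec d} {a : ℝ → Vec d → ℝ} (hu : SmoothAt u t x)
    (ha : SmoothAt a t x) (i : Fin d) :
    matDeriv u (fun s y => pd i (a s) y) t x =
      pd i (fun y => matDeriv u a t y) x
        - ∑ j, pd i (fun y => u t y j) x * pd j (a t) x := by
  have h1 : pd i (fun y => matDeriv u a t y) x = pd i (fun y => deriv (fun s => a s y) t) x +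
      ∑ j, (u t x j * pd i (fun y => pd j (a t) y) x +
        pd j (a t) x * pd i (fun y => u t y j) x) := by
    simp only [matDeriv, fderiv_eq_sum_pd]
    rw [pd_add ha.deriv_time.slice_differentiableAt
      (SmoothAt.sum fun j _ => (hu.coord j).mul (ha.pd j)).slice_differentiableAt,
      pd_sum fun j _ => ((hu.coord j).mul (ha.pd j)).slice_differentiableAt]
    congr 1
    refine Finset.sum_congr rfl fun j _ => ?_
    rw [pd_mul (hu.coord j).slice_differentiableAt (ha.pd j).slice_differentiableAt]
    ring
  have h2 : pd i (fun y => deriv (fun s => a s y) t) x = deriv (fun s => pd i (a s) x) t :=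
    ha.fderiv_deriv_comm _
  have h3 : ∀ j, pd i (fun y => pd j (a t) y) x = pd j (fun y => pd i (a t) y) x :=
    fun j => ha.fderiv_space_comm _ _
  rw [h1, h2, matDeriv, fderiv_eq_sum_pd, Finset.sum_add_distrib]
  simp only [h3, mul_comm (pd _ (a t) x)]
  ring

end Smooth

section Product

variable {d : ℕ} {x : Vec d}

theorem differentiableAt_coord {w : Vec d → Vec d} (hw : DifferentiableAt ℝ w x) (i : Fin d) :
    DifferentiableAt ℝ (fun y => w y i) x :=
  (differentiableAt_piLp 2).1 hw i

theorem divg_add {w z : Vec d → Vec d} (hw : DifferentiableAt ℝ w x)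
    (hz : DifferentiableAt ℝ z x) : divg (fun y => w y + z y) x = divg w x + divg z x := by
  simp only [divg, ← Finset.sum_add_distrib]
  refine Finset.sum_congr rfl fun i _ => ?_
  simp only [PiLp.add_apply]
  exact pd_add (differentiableAt_coord hw i) (differentiableAt_coord hz i) i

theorem divg_sub {w z : Vec d → Vec d} (hw : DifferentiableAt ℝ w x)
    (hz : DifferentiableAt ℝ z x) : divg (fun y => w y - z y) x = divg w x - divg z x := by
  simp only [divg, ← Finset.sum_sub_distrib]
  refine Finset.sum_congr rfl fun i _ => ?_
  simp only [PiLp.sub_apply]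
  exact pd_sub (differentiableAt_coord hw i) (differentiableAt_coord hz i) i

theorem divg_smul {a : Vec d → ℝ} {w : Vec d → Vec d} (ha : DifferentiableAt ℝ a x)
    (hw : DifferentiableAt ℝ w x) :
    divg (fun y => a y • w y) x = a x * divg w x + ∑ j, pd j a x * w x j := by
  simp only [divg, Finset.mul_sum, ← Finset.sum_add_distrib]
  refine Finset.sum_congr rfl fun i _ => ?_
  simp only [PiLp.smul_apply, smul_eq_mul]
  exact pd_mul ha (differentiableAt_coord hw i) i

/-- The vector field `Aᵀ w`. -/
def matVec (A : Vec d → Matrix (Fin d) (Fin d) ℝ) (w : Vec d → Vec d) (x : Vec d) : Vec d :=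
  WithLp.toLp 2 fun j => ∑ i, A x i j * w x i

theorem divg_matVec {A : Vec d → Matrix (Fin d) (Fin d) ℝ} {w : Vec d → Vec d}
    (hA : ∀ i j, DifferentiableAt ℝ (fun y => A y i j) x) (hw : DifferentiableAt ℝ w x) :
    divg (matVec A w) x =
      (∑ i, w x i * matDiv A x i) + ∑ i, ∑ j, A x i j * pd j (fun y => w y i) x := by
  have h1 : ∀ j, pd j (fun y => matVec A w y j) x =
      ∑ i, (A x i j * pd j (fun y => w y i) x + pd j (fun y => A y i j) x * w x i) := by
    intro j
    simp only [matVec]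
    rw [pd_sum (a := fun i y => A y i j * w y i)
      fun i _ => (hA i j).mul (differentiableAt_coord hw i)]
    exact Finset.sum_congr rfl fun i _ => pd_mul (hA i j) (differentiableAt_coord hw i) j
  simp only [divg, h1, matDiv, Finset.mul_sum, Finset.sum_add_distrib]
  rw [add_comm, Finset.sum_comm]
  congr 1
  · exact Finset.sum_congr rfl fun i _ => Finset.sum_congr rfl fun j _ => mul_comm _ _
  · exact Finset.sum_comm

end Product

/-! ### Differentiation under the integral sign -/

section Param

variable {d : ℕ}

theorem hasDerivAt_integral_of_smoothAt {J : Set ℝ} (hJ : IsOpen J) {K : Set (Vec d)}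
    (hK : IsCompact K) {μ : Measure (Vec d)} [IsFiniteMeasure μ] (hμ : ∀ᵐ x ∂μ, x ∈ K)
    {f : ℝ → Vec d → ℝ} (hf : ∀ t ∈ J, ∀ x ∈ K, SmoothAt f t x) {t : ℝ} (ht : t ∈ J) :
    HasDerivAt (fun s => ∫ x, f s x ∂μ) (∫ x, deriv (fun s => f s x) t ∂μ) t := by
  obtain ⟨ε, hε, hεJ⟩ := Metric.nhds_basis_closedBall.mem_iff.1 (hJ.mem_nhds ht)
  have hcont : ContinuousOn (fun q : ℝ × Vec d => deriv (fun s => f s q.2) q.1)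
      (Metric.closedBall t ε ×ˢ K) := fun q hq =>
    (ContDiffAt.continuousAt (hf q.1 (hεJ hq.1) q.2 hq.2).deriv_time).continuousWithinAt
  obtain ⟨C, hC⟩ := ((isCompact_closedBall t ε).prod hK).exists_bound_of_continuousOn hcont
  have hmeas : ∀ g : Vec d → ℝ, ContinuousOn g K → AEStronglyMeasurable g μ := by
    intro g hg
    have := hg.aestronglyMeasurable (μ := μ) hK.measurableSet
    rwa [Measure.restrict_eq_self_of_ae_mem hμ] at this
  have hfc : ∀ s ∈ J, ContinuousOn (f s) K := fun s hs x hx =>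
    (hf s hs x hx).slice.continuousAt.continuousWithinAt
  refine (hasDerivAt_integral_of_dominated_loc_of_deriv_le (μ := μ) (F := f)
    (F' := fun s x => deriv (fun r => f r x) s) (bound := fun _ => C)
    (Metric.closedBall_mem_nhds t hε) ?_ ?_ ?_ ?_ (integrable_const (μ := μ) C) ?_).2
  · filter_upwards [hJ.mem_nhds ht] with s hs using hmeas _ (hfc s hs)
  · obtain ⟨B, hB⟩ := hK.exists_bound_of_continuousOn (hfc t ht)
    refine Integrable.of_bound (hmeas _ (hfc t ht)) B ?_
    filter_upwards [hμ] with x hx using hB x hx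
  · exact hmeas _ fun x hx => (hf t ht x hx).deriv_time.slice.continuousAt.continuousWithinAt
  · filter_upwards [hμ] with x hx s hs using hC (s, x) ⟨hs, hx⟩
  · filter_upwards [hμ] with x hx s hs using (hf s (hεJ hs) x hx).deriv_hasDerivAt

end Param

/-! ### The local energy balance -/

section Coefficients

variable (P : Params) {s : ℝ}

theorem hasDerivAt_mixture (a b s : ℝ) :
    HasDerivAt (fun s : ℝ => s / a + (1 - s) / b) (1 / a - 1 / b) s := by
  have h1 : HasDerivAt (fun s : ℝ => s / a) (1 / a) s := (hasDerivAt_id s).div_const a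
  have h2 : HasDerivAt (fun s : ℝ => (1 - s) / b) (-1 / b) s :=
    ((hasDerivAt_id s).const_sub 1).div_const b
  exact (h1.add h2).congr_deriv (by ring)

theorem contDiffAt_mixture_inv {a b : ℝ} (h : 0 < (s / a + (1 - s) / b)⁻¹) :
    ContDiffAt ℝ ∞ (fun s : ℝ => (s / a + (1 - s) / b)⁻¹) s := by
  apply ContDiffAt.inv
  · fun_prop
  · exact (inv_pos.1 h).ne'

theorem Params.contDiffAt_rho (h : 0 < P.rho s) : ContDiffAt ℝ ∞ P.rho s :=
  contDiffAt_mixture_inv h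

theorem Params.contDiffAt_eta (h : 0 < P.eta s) : ContDiffAt ℝ ∞ P.eta s :=
  contDiffAt_mixture_inv h

theorem Params.contDiffAt_beta (h : 0 < P.beta s) : ContDiffAt ℝ ∞ P.beta s :=
  contDiffAt_mixture_inv h

/-- `1/ρ` is affine in the phase field, with slope `α`. -/
theorem Params.deriv_rho (h : 0 < P.rho s) : deriv P.rho s = -P.alpha * P.rho s ^ 2 := by
  have h0 : s / P.rho1 + (1 - s) / P.rho2 ≠ 0 := (inv_pos.1 h).ne'
  have h1 : HasDerivAt P.rho _ s := (hasDerivAt_mixture P.rho1 P.rho2 s).inv h0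
  have hα : P.alpha = 1 / P.rho1 - 1 / P.rho2 := by
    have := P.rho1_pos.ne'
    have := P.rho2_pos.ne'
    rw [Params.alpha]; field_simp
  rw [h1.deriv, hα, Params.rho]
  field_simp

theorem Params.contDiff_fw : ContDiff ℝ ∞ P.fw := by
  unfold Params.fw; fun_prop

theorem contDiff_bulkG : ContDiff ℝ ∞ bulkG := by
  unfold bulkG; fun_prop

end Coefficients

section Balance

variable {d : ℕ} (P : Params)

/-- The energy per unit mass `|u|²/2 + λ_c (G(c) + (γ²/2)|∇c|²)`. -/
def specificEnergy (c : ℝ → Vec d → ℝ) (u : ℝ → Vec d → Vec d) (t : ℝ) (x : Vec d) : ℝ :=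
  ‖u t x‖ ^ 2 / 2 + P.lamC * (bulkG (c t x) + P.gam ^ 2 / 2 * ‖gradient (c t) x‖ ^ 2)

theorem kinDensity_add_mixDensity (c : ℝ → Vec d → ℝ) (u : ℝ → Vec d → Vec d) (t : ℝ)
    (x : Vec d) :
    kinDensity P c u t x + mixDensity P c t x = P.rho (c t x) * specificEnergy P c u t x := by
  rw [kinDensity, mixDensity, specificEnergy]; ring

/-- The viscous part `2ηD` of the stress. -/
def shearStress (c : ℝ → Vec d → ℝ) (u : ℝ → Vec d → Vec d) (t : ℝ) (x : Vec d) :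
    Matrix (Fin d) (Fin d) ℝ :=
  (2 * P.eta (c t x)) • strain (u t) x

/-- The capillary stress `λ_c γ² ρ ∇c ⊗ ∇c`. -/
def capStress (c : ℝ → Vec d → ℝ) (t : ℝ) (x : Vec d) : Matrix (Fin d) (Fin d) ℝ :=
  (P.lamC * P.gam ^ 2 * P.rho (c t x)) • tensor (gradient (c t) x) (gradient (c t) x)

/-- The part of the energy flux that is not due to transport: work of the stresses, of the
capillary forces and of the chemical potential. -/
def workFlux (c : ℝ → Vec d → ℝ) (u : ℝ → Vec d → Vec d) (p : ℝ → Vec d → ℝ)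
    (t : ℝ) (x : Vec d) : Vec d :=
  matVec (shearStress P c u t) (u t) x
    + (P.lam (c t x) * divg (u t) x) • u t x
    - p t x • u t x
    - matVec (capStress P c t) (u t) x
    + (P.lamC * P.gam ^ 2 * matDeriv u c t x) • (P.rho (c t x) • gradient (c t) x)
    + chemPot P c p t x • (P.mob (c t x) • gradient (chemPot P c p t) x)

/-- The total flux of energy. -/
def energyFlux (c : ℝ → Vec d → ℝ) (u : ℝ → Vec d → Vec d) (p : ℝ → Vec d → ℝ)
    (t : ℝ) (x : Vec d) : Vec d :=
  workFlux P c u p t x - (P.rho (c t x) * specificEnergy P c u t x) • u t x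

variable {P} {Ω : Set (Vec d)} {J : Set ℝ} {c : ℝ → Vec d → ℝ} {u : ℝ → Vec d → Vec d}
  {p : ℝ → Vec d → ℝ} {t : ℝ} {x : Vec d}

namespace IsSmoothSolution

theorem smoothAt_c (h : IsSmoothSolution P Ω J c u p) (ht : t ∈ J) (hx : x ∈ closure Ω) :
    SmoothAt c t x := h.smooth_c t ht x hx

theorem smoothAt_u (h : IsSmoothSolution P Ω J c u p) (ht : t ∈ J) (hx : x ∈ closure Ω) :
    SmoothAt u t x := h.smooth_u t ht x hx

theorem smoothAt_p (h : IsSmoothSolution P Ω J c u p) (ht : t ∈ J) (hx : x ∈ closure Ω) :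
    SmoothAt p t x := h.smooth_p t ht x hx

theorem smoothAt_rho (h : IsSmoothSolution P Ω J c u p) (ht : t ∈ J) (hx : x ∈ closure Ω) :
    SmoothAt (fun s y => P.rho (c s y)) t x :=
  (h.smoothAt_c ht hx).comp (P.contDiffAt_rho (h.rho_pos t ht x hx))

theorem smoothAt_eta (h : IsSmoothSolution P Ω J c u p) (ht : t ∈ J) (hx : x ∈ closure Ω) :
    SmoothAt (fun s y => P.eta (c s y)) t x :=
  (h.smoothAt_c ht hx).comp (P.contDiffAt_eta (h.eta_pos t ht x hx))

theorem smoothAt_lam (h : IsSmoothSolution P Ω J c u p) (ht : t ∈ J) (hx : x ∈ closure Ω) :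
    SmoothAt (fun s y => P.lam (c s y)) t x :=
  (h.smoothAt_c ht hx).comp (h.smooth_lam t ht x hx)

theorem smoothAt_mob (h : IsSmoothSolution P Ω J c u p) (ht : t ∈ J) (hx : x ∈ closure Ω) :
    SmoothAt (fun s y => P.mob (c s y)) t x :=
  (h.smoothAt_c ht hx).comp (h.smooth_mob t ht x hx)

theorem smoothAt_bulkG (h : IsSmoothSolution P Ω J c u p) (ht : t ∈ J) (hx : x ∈ closure Ω) :
    SmoothAt (fun s y => bulkG (c s y)) t x :=
  (h.smoothAt_c ht hx).comp contDiff_bulkG.contDiffAt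

theorem smoothAt_fw (h : IsSmoothSolution P Ω J c u p) (ht : t ∈ J) (hx : x ∈ closure Ω) :
    SmoothAt (fun s y => P.fw (c s y)) t x :=
  (h.smoothAt_c ht hx).comp P.contDiff_fw.contDiffAt

theorem smoothAt_chemPot (h : IsSmoothSolution P Ω J c u p) (ht : t ∈ J)
    (hx : x ∈ closure Ω) : SmoothAt (chemPot P c p) t x := by
  have hc := h.smoothAt_c ht hx
  have hρ := h.smoothAt_rho ht hx
  have hG : ContDiff ℝ ∞ (deriv bulkG) := by
    have := contDiff_bulkG
    rw [contDiff_infty_iff_deriv] at this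
    exact this.2
  have hinv : SmoothAt (fun s y => P.lamC * P.gam ^ 2 / P.rho (c s y)) t x :=
    ContDiffAt.div contDiffAt_const hρ (h.rho_pos t ht x hx).ne'
  exact (((hc.comp hG.contDiffAt).const_mul _).sub (hinv.mul (hρ.smul hc.gradient).divg)).add
    ((h.smoothAt_p ht hx).const_mul _)

theorem smoothAt_specificEnergy (h : IsSmoothSolution P Ω J c u p) (ht : t ∈ J)
    (hx : x ∈ closure Ω) : SmoothAt (specificEnergy P c u) t x :=
  ((h.smoothAt_u ht hx).norm_sq.div_const 2).add (((h.smoothAt_bulkG ht hx).add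
    ((h.smoothAt_c ht hx).gradient.norm_sq.const_mul _)).const_mul _)

theorem smoothAt_shearStress (h : IsSmoothSolution P Ω J c u p) (ht : t ∈ J)
    (hx : x ∈ closure Ω) (i j : Fin d) : SmoothAt (fun s y => shearStress P c u s y i j) t x :=
  ((h.smoothAt_eta ht hx).const_mul 2).mul ((h.smoothAt_u ht hx).strain i j)

theorem smoothAt_capStress (h : IsSmoothSolution P Ω J c u p) (ht : t ∈ J)
    (hx : x ∈ closure Ω) (i j : Fin d) : SmoothAt (fun s y => capStress P c s y i j) t x :=
  ((h.smoothAt_rho ht hx).const_mul _).mul (((h.smoothAt_c ht hx).gradient.coord i).mul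
    ((h.smoothAt_c ht hx).gradient.coord j))

end IsSmoothSolution

theorem SmoothAt.matVec {A : ℝ → Vec d → Matrix (Fin d) (Fin d) ℝ} {w : ℝ → Vec d → Vec d}
    (hA : ∀ i j, SmoothAt (fun s y => A s y i j) t x) (hw : SmoothAt w t x) :
    SmoothAt (fun s y => QNSCH.matVec (A s) (w s) y) t x :=
  SmoothAt.toLp fun j => SmoothAt.sum fun i _ => (hA i j).mul (hw.coord i)

theorem IsSmoothSolution.smoothAt_workFlux (h : IsSmoothSolution P Ω J c u p) (ht : t ∈ J)
    (hx : x ∈ closure Ω) : SmoothAt (workFlux P c u p) t x := by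
  have hu := h.smoothAt_u ht hx
  have hc := h.smoothAt_c ht hx
  exact (((((SmoothAt.matVec (h.smoothAt_shearStress ht hx) hu).add
    (((h.smoothAt_lam ht hx).mul hu.divg).smul hu)).sub ((h.smoothAt_p ht hx).smul hu)).sub
    (SmoothAt.matVec (h.smoothAt_capStress ht hx) hu)).add
    (((hu.matDeriv hc).const_mul _).smul ((h.smoothAt_rho ht hx).smul hc.gradient))).add
    ((h.smoothAt_chemPot ht hx).smul ((h.smoothAt_mob ht hx).smul
      (h.smoothAt_chemPot ht hx).gradient))

theorem IsSmoothSolution.smoothAt_energyFlux (h : IsSmoothSolution P Ω J c u p) (ht : t ∈ J)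
    (hx : x ∈ closure Ω) : SmoothAt (energyFlux P c u p) t x :=
  (h.smoothAt_workFlux ht hx).sub (((h.smoothAt_rho ht hx).mul
    (h.smoothAt_specificEnergy ht hx)).smul (h.smoothAt_u ht hx))

/-- The strain is symmetric, so only the symmetric part of the velocity gradient does work
against it. -/
theorem sum_strain_mul_pd (w : Vec d → Vec d) (x : Vec d) :
    ∑ i, ∑ j, strain w x i j * pd j (fun y => w y i) x = ∑ i, ∑ j, strain w x i j ^ 2 := by
  have hsymm : ∀ i j, strain w x i j = strain w x j i := by
    intro i j; simp [strain, add_comm]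
  have h1 : ∑ i, ∑ j, strain w x i j * pd j (fun y => w y i) x =
      ∑ i, ∑ j, strain w x i j * pd i (fun y => w y j) x := by
    rw [Finset.sum_comm]
    exact Finset.sum_congr rfl fun i _ => Finset.sum_congr rfl fun j _ => by rw [hsymm]
  have h2 : ∑ i, ∑ j, strain w x i j ^ 2 =
      (∑ i, ∑ j, strain w x i j * pd j (fun y => w y i) x +
        ∑ i, ∑ j, strain w x i j * pd i (fun y => w y j) x) / 2 := by
    simp only [← Finset.sum_add_distrib, Finset.sum_div]
    refine Finset.sum_congr rfl fun i _ => Finset.sum_congr rfl fun j _ => ?_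
    simp only [strain, Matrix.of_apply]; ring
  rw [h2, ← h1]; ring

theorem IsSmoothSolution.matDeriv_specificEnergy (h : IsSmoothSolution P Ω J c u p) (ht : t ∈ J)
    (hx : x ∈ closure Ω) :
    matDeriv u (specificEnergy P c u) t x =
      (∑ i, u t x i * matDeriv u u t x i) + P.lamC * (deriv bulkG (c t x) * matDeriv u c t x
        + P.gam ^ 2 * ((∑ i, pd i (c t) x * pd i (fun y => matDeriv u c t y) x)
          - ∑ i, ∑ j, pd i (c t) x * pd j (c t) x * pd j (fun y => u t y i) x)) := by
  have hu := h.smoothAt_u ht hx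
  have hc := h.smoothAt_c ht hx
  have hk : specificEnergy P c u = fun s y =>
      (1 / 2) * (∑ i, u s y i * u s y i) + P.lamC * (bulkG (c s y)
        + P.gam ^ 2 / 2 * ∑ i, pd i (c s) y * pd i (c s) y) := by
    funext s y
    simp only [specificEnergy, EuclideanSpace.real_norm_sq_eq, gradient_apply, ← sq]
    ring
  have hsu := SmoothAt.sum (s := Finset.univ) fun i _ => (hu.coord i).mul (hu.coord i)
  have hsc := SmoothAt.sum (s := Finset.univ) fun i _ => (hc.pd i).mul (hc.pd i)
  have hG := h.smoothAt_bulkG ht hx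
  have hcomm : ∑ i, ∑ j, pd i (c t) x * pd j (c t) x * pd j (fun y => u t y i) x =
      ∑ i, pd i (c t) x * ∑ j, pd i (fun y => u t y j) x * pd j (c t) x := by
    simp only [Finset.mul_sum]
    rw [Finset.sum_comm]
    exact Finset.sum_congr rfl fun i _ => Finset.sum_congr rfl fun j _ => by ring
  rw [hk, matDeriv_add (hsu.const_mul _) ((hG.add (hsc.const_mul _)).const_mul _),
    matDeriv_const_mul _ hsu, matDeriv_const_mul _ (hG.add (hsc.const_mul _)),
    matDeriv_add hG (hsc.const_mul _), matDeriv_const_mul _ hsc,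
    matDeriv_comp contDiff_bulkG.contDiffAt hc,
    matDeriv_sum fun i _ => (hu.coord i).mul (hu.coord i),
    matDeriv_sum fun i _ => (hc.pd i).mul (hc.pd i), hcomm, ← Finset.sum_sub_distrib]
  have e1 : ∀ i, matDeriv u (fun s y => u s y i * u s y i) t x =
      2 * (u t x i * matDeriv u u t x i) := by
    intro i
    rw [matDeriv_mul (hu.coord i) (hu.coord i), matDeriv_apply hu]; ring
  have e2 : ∀ i, matDeriv u (fun s y => pd i (c s) y * pd i (c s) y) t x =
      2 * (pd i (c t) x * pd i (fun y => matDeriv u c t y) x -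
        pd i (c t) x * ∑ j, pd i (fun y => u t y j) x * pd j (c t) x) := by
    intro i
    rw [matDeriv_mul (hc.pd i) (hc.pd i), matDeriv_pd hu hc]; ring
  simp only [e1, e2, ← Finset.mul_sum]
  ring

/-- The conservation of mass ties the divergence of the velocity to the phase field. -/
theorem IsSmoothSolution.divg_eq (h : IsSmoothSolution P Ω J c u p) (ht : t ∈ J) (hx : x ∈ Ω) :
    divg (u t) x = P.alpha * P.rho (c t x) * matDeriv u c t x := by
  have hx' := subset_closure hx
  have hpos := h.rho_pos t ht x hx'
  have h1 := h.mass_eq t ht x hx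
  rw [matDeriv_comp (P.contDiffAt_rho hpos) (h.smoothAt_c ht hx'), P.deriv_rho hpos] at h1
  apply mul_left_cancel₀ hpos.ne'
  linear_combination h1

/-- The divergence of the work flux: the production of specific energy, plus the dissipation. -/
theorem IsSmoothSolution.divg_workFlux (h : IsSmoothSolution P Ω J c u p) (ht : t ∈ J)
    (hx : x ∈ Ω) :
    divg (workFlux P c u p t) x = P.rho (c t x) * matDeriv u (specificEnergy P c u) t x
      + shearDissip P c u t x + bulkDissip P c u t x + diffDissip P c p t x := by
  have hx' := subset_closure hx
  have hu := h.smoothAt_u ht hx'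
  have hc := h.smoothAt_c ht hx'
  have hp := h.smoothAt_p ht hx'
  have hρ := h.smoothAt_rho ht hx'
  have hM := h.smoothAt_mob ht hx'
  have hμ := h.smoothAt_chemPot ht hx'
  have hld := (h.smoothAt_lam ht hx').mul hu.divg
  have hT := SmoothAt.matVec (h.smoothAt_shearStress ht hx') hu
  have hS := SmoothAt.matVec (h.smoothAt_capStress ht hx') hu
  have hċ := (hu.matDeriv hc).const_mul (P.lamC * P.gam ^ 2)
  have hρc := hρ.smul hc.gradient
  have hMμ := hM.smul hμ.gradient
  have hpos := h.rho_pos t ht x hx'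
  have e0 : divg (workFlux P c u p t) x =
      divg (matVec (shearStress P c u t) (u t)) x
      + divg (fun y => (P.lam (c t y) * divg (u t) y) • u t y) x
      - divg (fun y => p t y • u t y) x
      - divg (matVec (capStress P c t) (u t)) x
      + divg (fun y => (P.lamC * P.gam ^ 2 * matDeriv u c t y) •
          (P.rho (c t y) • gradient (c t) y)) x
      + divg (fun y => chemPot P c p t y •
          (P.mob (c t y) • gradient (chemPot P c p t) y)) x := by
    have s1 := hT.add (hld.smul hu)
    have s2 := s1.sub (hp.smul hu)
    have s3 := s2.sub hS
    have s4 := s3.add (hċ.smul hρc)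
    rw [← divg_add hT.slice_differentiableAt (hld.smul hu).slice_differentiableAt,
      ← divg_sub s1.slice_differentiableAt (hp.smul hu).slice_differentiableAt,
      ← divg_sub s2.slice_differentiableAt hS.slice_differentiableAt,
      ← divg_add s3.slice_differentiableAt (hċ.smul hρc).slice_differentiableAt,
      ← divg_add s4.slice_differentiableAt (hμ.smul hMμ).slice_differentiableAt]
    rfl
  have e1 := divg_matVec (A := shearStress P c u t) (w := u t)
    (fun i j => (h.smoothAt_shearStress ht hx' i j).slice_differentiableAt)
    hu.slice_differentiableAt
  have e2 := divg_matVec (A := capStress P c t) (w := u t)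
    (fun i j => (h.smoothAt_capStress ht hx' i j).slice_differentiableAt)
    hu.slice_differentiableAt
  have e3 := divg_smul hld.slice_differentiableAt hu.slice_differentiableAt
  have e4 := divg_smul hp.slice_differentiableAt hu.slice_differentiableAt
  have e5 := divg_smul hċ.slice_differentiableAt hρc.slice_differentiableAt
  have e6 := divg_smul hμ.slice_differentiableAt hMμ.slice_differentiableAt
  have e1' : ∑ i, ∑ j, shearStress P c u t x i j * pd j (fun y => u t y i) x =
      shearDissip P c u t x := by
    simp only [shearStress, Matrix.smul_apply, smul_eq_mul, mul_assoc, ← Finset.mul_sum,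
      sum_strain_mul_pd, shearDissip]
  have e2' : ∑ i, ∑ j, capStress P c t x i j * pd j (fun y => u t y i) x =
      P.lamC * P.gam ^ 2 * P.rho (c t x) *
        ∑ i, ∑ j, pd i (c t) x * pd j (c t) x * pd j (fun y => u t y i) x := by
    simp only [capStress, tensor, Matrix.smul_apply, Matrix.of_apply, smul_eq_mul, mul_assoc,
      ← Finset.mul_sum, gradient_apply]
  have e5' : ∑ j, pd j (fun y => P.lamC * P.gam ^ 2 * matDeriv u c t y) x *
      (P.rho (c t x) • gradient (c t) x) j =
      P.lamC * P.gam ^ 2 * P.rho (c t x) *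
        ∑ i, pd i (c t) x * pd i (fun y => matDeriv u c t y) x := by
    rw [Finset.mul_sum]
    refine Finset.sum_congr rfl fun j _ => ?_
    have : pd j (fun y => P.lamC * P.gam ^ 2 * matDeriv u c t y) x =
        P.lamC * P.gam ^ 2 * pd j (fun y => matDeriv u c t y) x := by
      unfold pd
      rw [fderiv_const_mul (hu.matDeriv hc).slice_differentiableAt]
      rfl
    rw [this, PiLp.smul_apply, smul_eq_mul, gradient_apply]; ring
  have e6' : ∑ j, pd j (chemPot P c p t) x *
      (P.mob (c t x) • gradient (chemPot P c p t) x) j = diffDissip P c p t x := by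
    simp only [diffDissip, EuclideanSpace.real_norm_sq_eq, Finset.mul_sum, gradient_apply,
      PiLp.smul_apply, smul_eq_mul]
    exact Finset.sum_congr rfl fun j _ => by ring
  -- the momentum equation, tested with the velocity
  have hmom : P.rho (c t x) * ∑ i, u t x i * matDeriv u u t x i =
      (∑ i, u t x i * matDiv (shearStress P c u t) x i)
      + (∑ j, pd j (fun y => P.lam (c t y) * divg (u t) y) x * u t x j)
      - (∑ j, pd j (p t) x * u t x j)
      - ∑ i, u t x i * matDiv (capStress P c t) x i := by
    rw [Finset.mul_sum, ← Finset.sum_add_distrib, ← Finset.sum_sub_distrib,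
      ← Finset.sum_sub_distrib]
    refine Finset.sum_congr rfl fun i _ => ?_
    have := congrArg (fun w : Vec d => w i) (h.momentum_eq t ht x hx)
    simp only [PiLp.smul_apply, PiLp.add_apply, PiLp.sub_apply, smul_eq_mul,
      gradient_apply] at this
    change P.rho (c t x) * matDeriv u u t x i = matDiv (shearStress P c u t) x i + _ - _ -
      matDiv (capStress P c t) x i at this
    linear_combination u t x i * this
  have hphase := h.phase_eq t ht x hx
  have hdiv := h.divg_eq ht hx
  have hchem : P.rho (c t x) * chemPot P c p t x = P.rho (c t x) * (P.lamC * deriv bulkG (c t x))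
      - P.lamC * P.gam ^ 2 * divg (fun y => P.rho (c t y) • gradient (c t) y) x
      + P.rho (c t x) * (P.alpha * p t x) := by
    rw [chemPot]; field_simp
  rw [e0, e1, e2, e3, e4, e5, e6, e1', e2', e5', e6', ← hphase,
    h.matDeriv_specificEnergy ht hx', bulkDissip]
  linear_combination -hmom + matDeriv u c t x * hchem - p t x * hdiv

/-- **Local energy balance**. -/
theorem IsSmoothSolution.energy_balance (h : IsSmoothSolution P Ω J c u p) (ht : t ∈ J)
    (hx : x ∈ Ω) :
    deriv (fun s => kinDensity P c u s x + mixDensity P c s x) t =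
      divg (energyFlux P c u p t) x
        - shearDissip P c u t x - bulkDissip P c u t x - diffDissip P c p t x := by
  have hx' := subset_closure hx
  have hu := h.smoothAt_u ht hx'
  have hρ := h.smoothAt_rho ht hx'
  have hk := h.smoothAt_specificEnergy ht hx'
  have hρk := hρ.mul hk
  have e1 := divg_smul hρk.slice_differentiableAt hu.slice_differentiableAt
  have e2 : divg (energyFlux P c u p t) x = divg (workFlux P c u p t) x -
      divg (fun y => (P.rho (c t y) * specificEnergy P c u t y) • u t y) x :=
    divg_sub (h.smoothAt_workFlux ht hx').slice_differentiableAt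
      (hρk.smul hu).slice_differentiableAt
  have e3 := matDeriv_mul (u := u) hρ hk
  have e4 := h.mass_eq t ht x hx
  rw [matDeriv, fderiv_eq_sum_pd] at e3
  simp only [kinDensity_add_mixDensity]
  have e5 : ∑ j, pd j (fun y => P.rho (c t y) * specificEnergy P c u t y) x * u t x j =
      ∑ j, u t x j * pd j (fun y => P.rho (c t y) * specificEnergy P c u t y) x :=
    Finset.sum_congr rfl fun j _ => mul_comm _ _
  rw [e2, e1, h.divg_workFlux ht hx, e5]
  linear_combination e3 + specificEnergy P c u t x * e4

end Balance

/-! ### The energy balance on the wall -/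

section Wall

variable {d : ℕ} {P : Params} {Ω : Set (Vec d)} {J : Set ℝ} {c : ℝ → Vec d → ℝ}
  {u : ℝ → Vec d → Vec d} {p : ℝ → Vec d → ℝ} {t : ℝ} {x n : Vec d}

theorem inner_matVec (A : Vec d → Matrix (Fin d) (Fin d) ℝ) (w : Vec d → Vec d) (x n : Vec d) :
    inner ℝ (matVec A w x) n = ∑ i, ∑ j, A x i j * w x i * n j := by
  rw [Finset.sum_comm, PiLp.inner_apply]
  refine Finset.sum_congr rfl fun j _ => ?_
  simp [matVec, Finset.mul_sum, mul_comm]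

/-- On the wall, the energy flux and the change of the wall energy add up to the wall
dissipation. -/
theorem IsSmoothSolution.wall_balance (h : IsSmoothSolution P Ω J c u p) (ht : t ∈ J)
    (hx : x ∈ frontier Ω) (hn : IsOuterUnitNormal Ω x n) :
    inner ℝ (energyFlux P c u p t x) n + deriv (fun s => P.fw (c s x)) t =
      -(P.mobW (c t x) * wallL P c n t x ^ 2 + P.beta (c t x) * ‖slipVel u n t x‖ ^ 2) := by
  have hx' := frontier_subset_closure hx
  have hun := h.wall_normal t ht x hx n hn
  have hnu : inner ℝ n (u t x) = 0 := by rw [real_inner_comm]; exact hun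
  have hμ := h.wall_flux t ht x hx n hn
  have hslip : slipVel u n t x = u t x := by simp [slipVel, hun]
  have hβ := h.beta_pos t ht x hx
  -- the slip condition is tested with the velocity, which is tangent to the wall
  have e1 := h.wall_slip t ht x hx n hn (u t x) hun
  rw [hslip, real_inner_self_eq_norm_sq] at e1
  have e2 := h.wall_phase t ht x hx n hn
  rw [surfMatDeriv, surfGrad, inner_sub_right, inner_smul_right, hun, mul_zero, sub_zero] at e2
  have e3 : matDeriv u c t x = deriv (fun s => c s x) t + inner ℝ (u t x) (gradient (c t) x) := by
    rw [matDeriv, real_inner_comm, gradient, InnerProductSpace.toDual_symm_apply]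
  have e4 : deriv (fun s => P.fw (c s x)) t = deriv P.fw (c t x) * deriv (fun s => c s x) t := by
    have h1 := (P.contDiff_fw.differentiable (by simp) (c t x)).hasDerivAt
    exact (h1.comp t (h.smoothAt_c ht hx').deriv_hasDerivAt).deriv
  -- since `u · n = 0`, only the shear stress contributes to `n · σ · u`
  have e5 : n.ofLp ⬝ᵥ (viscStress P c u p t x *ᵥ (u t x).ofLp) =
      inner ℝ (matVec (shearStress P c u t) (u t) x) n := by
    have hdot : n.ofLp ⬝ᵥ (u t x).ofLp = 0 := by
      rw [← hun, PiLp.inner_apply]; simp [dotProduct]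
    have hsymm : ∀ i j, strain (u t) x i j = strain (u t) x j i := by
      intro i j; simp [strain, add_comm]
    rw [viscStress, Matrix.sub_mulVec, Matrix.add_mulVec, Matrix.smul_mulVec, Matrix.smul_mulVec,
      Matrix.smul_mulVec, Matrix.one_mulVec, dotProduct_sub, dotProduct_add, dotProduct_smul,
      dotProduct_smul, dotProduct_smul, hdot, inner_matVec, Finset.sum_comm]
    simp only [smul_eq_mul, mul_zero, add_zero, sub_zero, dotProduct, Matrix.mulVec, Finset.mul_sum,
      shearStress, Matrix.smul_apply]
    refine Finset.sum_congr rfl fun j _ => Finset.sum_congr rfl fun i _ => ?_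
    rw [hsymm j i]; ring
  have e6 : inner ℝ (matVec (capStress P c t) (u t) x) n =
      P.lamC * P.gam ^ 2 * P.rho (c t x) * inner ℝ (u t x) (gradient (c t) x) *
        inner ℝ (gradient (c t) x) n := by
    rw [inner_matVec, PiLp.inner_apply, PiLp.inner_apply, mul_assoc, Finset.sum_mul_sum,
      Finset.mul_sum]
    refine Finset.sum_congr rfl fun i _ => ?_
    rw [Finset.mul_sum]
    refine Finset.sum_congr rfl fun j _ => ?_
    simp [capStress, tensor]; ring
  have e7 : inner ℝ (energyFlux P c u p t x) n =
      inner ℝ (matVec (shearStress P c u t) (u t) x) n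
      - inner ℝ (matVec (capStress P c t) (u t) x) n
      + P.lamC * P.gam ^ 2 * matDeriv u c t x * (P.rho (c t x) *
          inner ℝ (gradient (c t) x) n) := by
    simp only [energyFlux, workFlux, inner_add_left, inner_sub_left, inner_smul_left, hun, hμ,
      RCLike.conj_to_real, mul_zero, add_zero, sub_zero]
  rw [e5] at e1
  have e8 : P.beta (c t x) * ‖u t x‖ ^ 2 =
      -inner ℝ (matVec (shearStress P c u t) (u t) x) n +
        wallL P c n t x * inner ℝ (u t x) (gradient (c t) x) := by
    rw [e1, mul_inv_cancel_left₀ hβ.ne']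
  have e9 : wallL P c n t x = P.rho (c t x) * P.lamC * P.gam ^ 2 *
      inner ℝ (gradient (c t) x) n + deriv P.fw (c t x) := by
    rw [wallL, real_inner_comm]
  rw [hslip, e7, e6, e4, e3, e8]
  linear_combination wallL P c n t x * e2 - deriv (fun s => c s x) t * e9

/-- The wall dissipation depends continuously on the point and the normal, taken as independent
variables; the normal itself is only measurable along the wall. -/
theorem IsSmoothSolution.continuousOn_wall (h : IsSmoothSolution P Ω J c u p) (ht : t ∈ J) :
    ContinuousOn (fun q : Vec d × Vec d => P.mobW (c t q.1) * wallL P c q.2 t q.1 ^ 2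
      + P.beta (c t q.1) * ‖slipVel u q.2 t q.1‖ ^ 2)
      (frontier Ω ×ˢ Metric.closedBall 0 1) := by
  have lift : ∀ {F : Type} [NormedAddCommGroup F] [NormedSpace ℝ F] {f : ℝ → Vec d → F},
      (∀ x ∈ frontier Ω, SmoothAt f t x) →
      ContinuousOn (fun q : Vec d × Vec d => f t q.1) (frontier Ω ×ˢ Metric.closedBall 0 1) := by
    intro F _ _ f hf
    exact ContinuousOn.comp (g := f t) (f := Prod.fst) (t := frontier Ω)
      (fun x hx => (hf x hx).slice.continuousAt.continuousWithinAt)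
      continuousOn_fst fun _ hq => hq.1
  have hfc : ∀ {x}, x ∈ frontier Ω → x ∈ closure Ω := fun hx => frontier_subset_closure hx
  have h1 := lift (f := fun s y => P.mobW (c s y)) fun x hx =>
    (h.smoothAt_c ht (hfc hx)).comp (h.smooth_mobW t ht x hx)
  have h2 := lift (f := fun s y => P.beta (c s y)) fun x hx =>
    (h.smoothAt_c ht (hfc hx)).comp (P.contDiffAt_beta (h.beta_pos t ht x hx))
  have h3 := lift (f := fun s y => P.rho (c s y)) fun x hx => h.smoothAt_rho ht (hfc hx)
  have hfw : ContDiff ℝ ∞ (deriv P.fw) := by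
    have := P.contDiff_fw
    rw [contDiff_infty_iff_deriv] at this
    exact this.2
  have h4 := lift (f := fun s y => deriv P.fw (c s y)) fun x hx =>
    (h.smoothAt_c ht (hfc hx)).comp hfw.contDiffAt
  have h5 := lift (f := fun s y => gradient (c s) y) fun x hx =>
    (h.smoothAt_c ht (hfc hx)).gradient
  have h6 := lift (f := u) fun x hx => h.smoothAt_u ht (hfc hx)
  have h7 : ContinuousOn (fun q : Vec d × Vec d => q.2)
      (frontier Ω ×ˢ Metric.closedBall 0 1) := continuousOn_snd
  have h8 : ContinuousOn (fun q : Vec d × Vec d => wallL P c q.2 t q.1)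
      (frontier Ω ×ˢ Metric.closedBall 0 1) :=
    (((h3.mul continuousOn_const).mul continuousOn_const).mul (h7.inner h5)).add h4
  have h9 : ContinuousOn (fun q : Vec d × Vec d => slipVel u q.2 t q.1)
      (frontier Ω ×ˢ Metric.closedBall 0 1) :=
    h6.sub (ContinuousOn.smul (f := fun q : Vec d × Vec d => inner ℝ (u t q.1) q.2)
      (h6.inner h7) h7)
  exact (h1.mul (h8.pow 2)).add (h2.mul (h9.norm.pow 2))

end Wall

end QNSCH

end

/-! ### The energy dissipation law -/

theorem mainTheorem1 (d : ℕ) (hd : 2 ≤ d) (P : QNSCH.Params)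
    (Ω : Set (QNSCH.Vec d)) (hΩ : QNSCH.IsLipschitzDomain Ω)
    (J : Set ℝ) (hJ : IsOpen J)
    (c : ℝ → QNSCH.Vec d → ℝ) (u : ℝ → QNSCH.Vec d → QNSCH.Vec d) (p : ℝ → QNSCH.Vec d → ℝ)
    (hsol : QNSCH.IsSmoothSolution P Ω J c u p) :
    ∀ t ∈ J,
      (IntegrableOn (QNSCH.kinDensity P c u t) Ω ∧
        IntegrableOn (QNSCH.mixDensity P c t) Ω ∧
        Integrable (fun x => P.fw (c t x)) (QNSCH.surfaceMeasure Ω)) ∧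
      (IntegrableOn (QNSCH.shearDissip P c u t) Ω ∧
        IntegrableOn (QNSCH.bulkDissip P c u t) Ω ∧
        IntegrableOn (QNSCH.diffDissip P c p t) Ω ∧
        Integrable (QNSCH.wallDissip P Ω c u t) (QNSCH.surfaceMeasure Ω)) ∧
      HasDerivAt (QNSCH.totalEnergy P Ω c u)
        (-(∫ x in Ω, QNSCH.shearDissip P c u t x)
          - (∫ x in Ω, QNSCH.bulkDissip P c u t x)
          - (∫ x in Ω, QNSCH.diffDissip P c p t x)
          - ∫ x, QNSCH.wallDissip P Ω c u t x ∂(QNSCH.surfaceMeasure Ω)) t := by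
  open QNSCH in
  intro t ht
  have := hΩ.isFiniteMeasure_surfaceMeasure hd
  have := hΩ.isFiniteMeasure_volume
  have hcont : ∀ {f : ℝ → Vec d → ℝ}, (∀ x ∈ closure Ω, SmoothAt f t x) →
      ContinuousOn (f t) (closure Ω) := fun hf x hx =>
    (hf x hx).slice.continuousAt.continuousWithinAt
  have skin : ∀ s ∈ J, ∀ x ∈ closure Ω, SmoothAt (kinDensity P c u) s x := fun s hs x hx =>
    ((hsol.smoothAt_rho hs hx).mul (hsol.smoothAt_u hs hx).norm_sq).div_const 2
  have smix : ∀ s ∈ J, ∀ x ∈ closure Ω, SmoothAt (mixDensity P c) s x := fun s hs x hx =>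
    ((hsol.smoothAt_rho hs hx).const_mul _).mul ((hsol.smoothAt_bulkG hs hx).add
      ((hsol.smoothAt_c hs hx).gradient.norm_sq.const_mul _))
  have sshear : ∀ x ∈ closure Ω, SmoothAt (shearDissip P c u) t x := fun x hx =>
    ((hsol.smoothAt_eta ht hx).const_mul 2).mul (SmoothAt.sum fun i _ => SmoothAt.sum fun j _ =>
      ((hsol.smoothAt_u ht hx).strain i j).pow 2)
  have sbulk : ∀ x ∈ closure Ω, SmoothAt (bulkDissip P c u) t x := fun x hx =>
    (hsol.smoothAt_lam ht hx).mul ((hsol.smoothAt_u ht hx).divg.pow 2)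
  have sdiff : ∀ x ∈ closure Ω, SmoothAt (diffDissip P c p) t x := fun x hx =>
    (hsol.smoothAt_mob ht hx).mul (hsol.smoothAt_chemPot ht hx).gradient.norm_sq
  have ishear := hΩ.integrableOn (hcont sshear)
  have ibulk := hΩ.integrableOn (hcont sbulk)
  have idiff := hΩ.integrableOn (hcont sdiff)
  have hflux : ∀ x ∈ closure Ω, ContDiffAt ℝ 1 (energyFlux P c u p t) x := fun x hx =>
    (hsol.smoothAt_energyFlux ht hx).slice_one
  have iwall : Integrable (wallDissip P Ω c u t) (surfaceMeasure Ω) :=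
    hΩ.integrable_comp_outerNormal hd (hsol.continuousOn_wall ht)
  refine ⟨⟨hΩ.integrableOn (hcont (skin t ht)), hΩ.integrableOn (hcont (smix t ht)),
    hΩ.integrable_surfaceMeasure hd fun x hx => (hsol.smoothAt_fw ht
      (frontier_subset_closure hx)).slice.continuousAt.continuousWithinAt⟩,
    ⟨ishear, ibulk, idiff, iwall⟩, ?_⟩
  have hmem : ∀ᵐ x ∂(volume.restrict Ω), x ∈ closure Ω := by
    filter_upwards [ae_restrict_mem hΩ.isOpen.measurableSet] with x hx using subset_closure hx
  have dkin := hasDerivAt_integral_of_smoothAt hJ hΩ.isCompact_closure hmem skin ht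
  have dmix := hasDerivAt_integral_of_smoothAt hJ hΩ.isCompact_closure hmem smix ht
  have dfw := hasDerivAt_integral_of_smoothAt hJ hΩ.isCompact_frontier
    (ae_surfaceMeasure_mem Ω) (f := fun s x => P.fw (c s x))
    (fun s hs x hx => hsol.smoothAt_fw hs (frontier_subset_closure hx)) ht
  refine ((dkin.add dmix).add dfw).congr_deriv ?_
  have ikin' := hΩ.integrableOn (hcont fun x hx => (skin t ht x hx).deriv_time)
  have imix' := hΩ.integrableOn (hcont fun x hx => (smix t ht x hx).deriv_time)
  have idiv := hΩ.integrableOn (continuousOn_divg hflux)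
  have hbulk : (∫ x in Ω, deriv (fun s => kinDensity P c u s x) t) +
      ∫ x in Ω, deriv (fun s => mixDensity P c s x) t =
      (∫ x in Ω, divg (energyFlux P c u p t) x) - (∫ x in Ω, shearDissip P c u t x)
        - (∫ x in Ω, bulkDissip P c u t x) - ∫ x in Ω, diffDissip P c p t x := by
    have i1 : IntegrableOn (fun x => divg (energyFlux P c u p t) x - shearDissip P c u t x) Ω :=
      idiv.sub ishear
    have i2 : IntegrableOn (fun x => divg (energyFlux P c u p t) x - shearDissip P c u t x
      - bulkDissip P c u t x) Ω := i1.sub ibulk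
    rw [← integral_add ikin' imix', ← integral_sub idiv ishear, ← integral_sub i1 ibulk,
      ← integral_sub i2 idiff]
    apply setIntegral_congr_fun hΩ.isOpen.measurableSet
    intro x hx
    have hx' := subset_closure hx
    have := hsol.energy_balance ht hx
    exact ((skin t ht x hx').deriv_hasDerivAt.add
      (smix t ht x hx').deriv_hasDerivAt).deriv.symm.trans this
  have iflux : Integrable (fun x => inner ℝ (energyFlux P c u p t x) (outerNormal Ω x))
      (surfaceMeasure Ω) := by
    apply hΩ.integrable_comp_outerNormal hd (F := fun q => inner ℝ (energyFlux P c u p t q.1) q.2)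
    refine ContinuousOn.inner ?_ continuousOn_snd
    exact ContinuousOn.comp (g := energyFlux P c u p t) (f := Prod.fst) (t := frontier Ω)
      (fun x hx => (hflux x (frontier_subset_closure hx)).continuousAt.continuousWithinAt)
      continuousOn_fst fun _ hq => hq.1
  have ifw' : Integrable (fun x => deriv (fun s => P.fw (c s x)) t) (surfaceMeasure Ω) :=
    hΩ.integrable_surfaceMeasure hd fun x hx => (hsol.smoothAt_fw ht
      (frontier_subset_closure hx)).deriv_time.slice.continuousAt.continuousWithinAt
  have hwall : (∫ x in Ω, divg (energyFlux P c u p t) x) +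
      ∫ x, deriv (fun s => P.fw (c s x)) t ∂(surfaceMeasure Ω) =
      -∫ x, wallDissip P Ω c u t x ∂(surfaceMeasure Ω) := by
    rw [hΩ.setIntegral_divg hd hflux, ← integral_add iflux ifw', ← integral_neg]
    apply integral_congr_ae
    filter_upwards [hΩ.ae_isOuterUnitNormal hd] with x hx
    exact hsol.wall_balance ht hx.1 hx.2
  rw [hbulk]
  linear_combination hwall
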